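/- Notation. $(a)_0=1$, $(a)_n=a(a+1)\cdots(a+n-1)$. For real parameters $\alpha,\beta$ the Hendriksen–van Rossum (HR) polynomials are $$P_n(z)=P_n(z;\alpha,\beta)=\frac{(\beta)_n}{(\alpha+1)_n}\,{}_2F_1\!\left(-n,\alpha+1;1-\beta-n;z\right),$$ and $$w(z)=(-z)^{-\beta}(1-z)^{\alpha+\beta},\qquad h_n=\prod_{k=0}^{\infty}\frac{(\alpha+n+1+k)(\beta+n+1+k)}{(n+1+k)(\alpha+\beta+n+1+k)},$$ where the powers in $w$ are principal powers of $-z$ and $1-z$. For an integer $l_0\ge 1$ and $n\ge 0$ the exceptional HR polynomials of types $j_0=1,2,3,4$ (terms with the factor $n$ are $0$ for $n=0$) are $$P^{(1,l_0,n)}(z)=nP_{l_0}(z)P_{n-1}(z;\alpha+1,\beta)-l_0P_{l_0-1}(z;\alpha+1,\beta)P_n(z),$$ $$P^{(2,l_0,n)}(z)=(1-z)\left[nP_{l_0}(z;-\beta,-\alpha)P_{n-1}(z;\alpha+1,\beta)-l_0P_{l_0-1}(z;1-\beta,-\alpha)P_n(z)\right]-(\alpha+\beta)P_{l_0}(z;-\beta,-\alpha)P_n(z),$$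 $$P^{(3,l_0,n)}(z)=\tfrac{(\beta)_{l_0}}{(\alpha+1)_{l_0}}\Big[nzP_{l_0}(z;\beta-1,\alpha+1)P_{n-1}(z;\alpha+1,\beta)+\tfrac{(\alpha+1)l_0}{\beta+l_0-1}P_{l_0-1}(z;\beta-1,\alpha+2)P_n(z)+(1+\alpha)P_{l_0}(z;\beta-1,\alpha+1)P_n(z)\Big],$$ $$P^{(4,l_0,n)}(z)=\tfrac{(-\alpha)_{l_0}}{(1-\beta)_{l_0}}\Big\{(z-1)\Big[nzP_{l_0}(z;-\alpha-1,1-\beta)P_{n-1}(z;\alpha+1,\beta)+\tfrac{(1-\beta)l_0}{l_0-1-\alpha}P_{l_0-1}(z;-\alpha-1,2-\beta)P_n(z)\Big]-\big(1-\beta-(1+\alpha)z\big)P_{l_0}(z;-\alpha-1,1-\beta)P_n(z)\Big\}.$$ Their partners $Q^{(j_0,l_0,n)}(z)$ are obtained from $P^{(j_0,l_0,n)}(z)$ by replacing $(\alpha,\beta)$ with $(\beta-1,\alpha+1)$. The weights are $$w^{(1,l_0)}(z)=\tfrac{(\beta)_{l_0}}{(1+\alpha)_{l_0}}\frac{z^{l_0}(z-1)w(z)}{D_1(z)^2},\qquad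 w^{(2,l_0)}(z)=\tfrac{(-\alpha)_{l_0}}{(1-\beta)_{l_0}}\frac{z^{1+l_0}w(z)}{(1-z)D_2(z)^2},$$ $$w^{(3,l_0)}(z)=\tfrac{(1+\alpha)_{l_0}}{(\beta)_{l_0}}\frac{z^{l_0}(z-1)w(z)}{D_3(z)^2},\qquad w^{(4,l_0)}(z)=\tfrac{(1-\beta)_{l_0}}{(-\alpha)_{l_0}}\frac{z^{1+l_0}w(z)}{(1-z)D_4(z)^2},$$ with $D_1=P_{l_0}(z;\alpha,\beta)$, $D_2=P_{l_0}(z;-\beta,-\alpha)$, $D_3=P_{l_0}(z;\beta-1,\alpha+1)$, $D_4=P_{l_0}(z;-\alpha-1,1-\beta)$. Finally let $\theta^{(1)}_{l}=l$, $\theta^{(2)}_l=l-\alpha-\beta$, $\theta^{(3)}_l=-l-1-\alpha-\beta$, $\theta^{(4)}_l=-l-1$. Theorem. Let $j_0\in\{1,2,3,4\}$, $l_0\ge1$, and let $\alpha,\beta\in\mathbb R$ satisfy $\alpha+\beta>-1$, $\alpha\notin\{-1,-2,\dots\}$, $\beta\notin\{0,-1,-2,\dots\}$. If $j_0\in\{2,4\}$,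 assume moreover $\alpha+\beta\ge0$, $\alpha\notin\{0,\dots,l_0-1\}$ and $\beta\notin\{1,\dots,l_0\}$. Assume that $D_{j_0}$ has no zero on the unit circle. Then for all integers $m,n\ge0$ (with $m\ne l_0$ and $n\ne l_0$ if $j_0=1$) the following integral converges absolutely and $$\frac1{2\pi}\int_0^{2\pi}w^{(j_0,l_0)}(e^{ix})\,P^{(j_0,l_0,m)}(e^{ix})\,Q^{(j_0,l_0,n)}(e^{-ix})\,dx=h^{(j_0,l_0)}_n\,\delta_{mn},\qquad h^{(j_0,l_0)}_n=-(n+\beta)\,(n-\theta^{(j_0)}_{l_0})\,h_n .$$ If $j_0=4$ and $\alpha+\beta>0$, the system extends by the additional state $P^{(4,l_0,-l_0-1)}=Q^{(4,l_0,-l_0-1)}=1$: the weight $w^{(4,l_0)}$ is absolutely integrable on the unit circle, and for all $n\ge0$ $$\frac1{2\pi}\int_0^{2\pi}w^{(4,l_0)}(e^{ix})P^{(4,l_0,n)}(e^{ix})\,dx=0=\frac1{2\pi}\int_0^{2\pi}w^{(4,l_0)}(e^{ix})Q^{(4,l_0,n)}(e^{-ix})\,dx,$$ both integrals converging absolutely.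 -/

import Mathlib

open scoped BigOperators

noncomputable section

/-- The Hendriksen--van Rossum polynomial
`P_n(z; α, β) = ((β)_n / (α + 1)_n) * ₂F₁(-n, α + 1; 1 - β - n; z)`.
The hypergeometric series terminates since its first parameter is `-n`. -/
def hrPoly (n : ℕ) (α β : ℝ) (z : ℂ) : ℂ :=
  (((ascPochhammer ℝ n).eval β / (ascPochhammer ℝ n).eval (α + 1) : ℝ) : ℂ) *
    ordinaryHypergeometric (-(n : ℝ)) (α + 1) (1 - β - n) z

/-- The weight `w(z) = (-z)^(-β) * (1 - z)^(α + β)`. The complex powers of Mathlib use the principal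
argument of the base, so `(-z)^(-β)` is positive on the negative half-line and is cut along the
positive one, and `(1 - z)^(α + β)` is positive for `z < 1`. -/
def hrWeight (α β : ℝ) (z : ℂ) : ℂ :=
  (-z) ^ (-(β : ℂ)) * (1 - z) ^ ((α : ℂ) + (β : ℂ))

/-- The constant `h_n`, i.e.
`(α + n + 1)_∞ (β + n + 1)_∞ / ((n + 1)_∞ (α + β + n + 1)_∞)`, read as the convergent infinite
product of the quotients of the factors. -/
def hrNorm (n : ℕ) (α β : ℝ) : ℝ :=
  ∏' k : ℕ, ((α + n + 1 + k) * (β + n + 1 + k)) / (((n : ℝ) + 1 + k) * (α + β + n + 1 + k))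

/-- The four classes of quasi-Laurent-polynomial eigenfunctions that may serve as seed. -/
inductive SeedType : Type
  | one
  | two
  | three
  | four

/-- The eigenvalue `θ^{(j)}_l` of the seed function. -/
def seedEigenvalue (j : SeedType) (l : ℕ) (α β : ℝ) : ℝ :=
  match j with
  | .one => l
  | .two => l - α - β
  | .three => -l - 1 - α - β
  | .four => -l - 1

/-- The exceptional Hendriksen--van Rossum polynomials `P^{(j,l,n)}(z; α, β)` for `n ≥ 0`. -/
def xhrPoly (j : SeedType) (l n : ℕ) (α β : ℝ) (z : ℂ) : ℂ :=
  match j with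
  | .one =>
      n * hrPoly l α β z * hrPoly (n - 1) (α + 1) β z
        - l * hrPoly (l - 1) (α + 1) β z * hrPoly n α β z
  | .two =>
      (1 - z) * (n * hrPoly l (-β) (-α) z * hrPoly (n - 1) (α + 1) β z
        - l * hrPoly (l - 1) (1 - β) (-α) z * hrPoly n α β z)
        - (α + β) * hrPoly l (-β) (-α) z * hrPoly n α β z
  | .three =>
      (((ascPochhammer ℝ l).eval β / (ascPochhammer ℝ l).eval (α + 1) : ℝ) : ℂ) *
        (n * z * hrPoly l (β - 1) (α + 1) z * hrPoly (n - 1) (α + 1) β z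
          + (α + 1) * l / (β + l - 1) * hrPoly (l - 1) (β - 1) (α + 2) z * hrPoly n α β z
          + (1 + α) * hrPoly l (β - 1) (α + 1) z * hrPoly n α β z)
  | .four =>
      (((ascPochhammer ℝ l).eval (-α) / (ascPochhammer ℝ l).eval (-β + 1) : ℝ) : ℂ) *
        ((z - 1) * (n * z * hrPoly l (-α - 1) (-β + 1) z * hrPoly (n - 1) (α + 1) β z
          + (-β + 1) * l / (-α + l - 1) * hrPoly (l - 1) (-α - 1) (-β + 2) z * hrPoly n α β z)
          - (1 - β - (1 + α) * z) * hrPoly l (-α - 1) (-β + 1) z * hrPoly n α β z)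

/-- The partners `Q^{(j,l,n)}(z; α, β) = P^{(j,l,n)}(z; β - 1, α + 1)`. -/
def xhrPartner (j : SeedType) (l n : ℕ) (α β : ℝ) (z : ℂ) : ℂ :=
  xhrPoly j l n (β - 1) (α + 1) z

/-- The polynomial whose square is the denominator of the exceptional weight. -/
def xhrDenom (j : SeedType) (l : ℕ) (α β : ℝ) (z : ℂ) : ℂ :=
  match j with
  | .one => hrPoly l α β z
  | .two => hrPoly l (-β) (-α) z
  | .three => hrPoly l (β - 1) (α + 1) z
  | .four => hrPoly l (-α - 1) (-β + 1) z

/-- The exceptional weight functions `w^{(j,l)}(z)`. -/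
def xhrWeight (j : SeedType) (l : ℕ) (α β : ℝ) (z : ℂ) : ℂ :=
  match j with
  | .one =>
      (((ascPochhammer ℝ l).eval β / (ascPochhammer ℝ l).eval (1 + α) : ℝ) : ℂ) *
        (z ^ l * (z - 1) * hrWeight α β z / xhrDenom .one l α β z ^ 2)
  | .two =>
      (((ascPochhammer ℝ l).eval (-α) / (ascPochhammer ℝ l).eval (-β + 1) : ℝ) : ℂ) *
        (z ^ (1 + l) * hrWeight α β z / ((1 - z) * xhrDenom .two l α β z ^ 2))
  | .three =>
      (((ascPochhammer ℝ l).eval (1 + α) / (ascPochhammer ℝ l).eval β : ℝ) : ℂ) *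
        (z ^ l * (z - 1) * hrWeight α β z / xhrDenom .three l α β z ^ 2)
  | .four =>
      (((ascPochhammer ℝ l).eval (-β + 1) / (ascPochhammer ℝ l).eval (-α) : ℝ) : ℂ) *
        (z ^ (1 + l) * hrWeight α β z / ((1 - z) * xhrDenom .four l α β z ^ 2))

/-- The norms `h^{(j,l)}_n = -(n + β) (n - θ^{(j)}_l) h_n`. -/
def xhrNorm (j : SeedType) (l n : ℕ) (α β : ℝ) : ℝ :=
  -(n + β) * (n - seedEigenvalue j l α β) * hrNorm n α β

/-- `HasCirclePairing w P Q c`: the function `x ↦ w(e^{ix}) P(e^{ix}) Q(e^{-ix})` is integrable on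
`[0, 2π]` and `(1/2π) ∫_0^{2π} w(e^{ix}) P(e^{ix}) Q(e^{-ix}) dx = c`. -/
def HasCirclePairing (w P Q : ℂ → ℂ) (c : ℂ) : Prop :=
  IntervalIntegrable
    (fun x : ℝ => w (Complex.exp (Complex.I * x)) * P (Complex.exp (Complex.I * x)) *
      Q (Complex.exp (-(Complex.I * x)))) MeasureTheory.volume 0 (2 * Real.pi) ∧
  1 / (2 * (Real.pi : ℂ)) *
    (∫ x in (0 : ℝ)..(2 * Real.pi), w (Complex.exp (Complex.I * x)) *
      P (Complex.exp (Complex.I * x)) * Q (Complex.exp (-(Complex.I * x)))) = c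

end

/-! The hypergeometric equation of P_n is affine in n. With n replaced by a number θ it has further
elementary solutions φ = z^a (1-z)^(-s) D(z), where D is again a Hendriksen–van Rossum polynomial;
the four types are four such seeds. Put r = φ'/φ. Up to a constant and a factor clearing
denominators, the exceptional polynomial is the Darboux transform A = P_m' - r P_m. Since z ↦ 1/z
exchanges (α, β) with (β - 1, α + 1), its partner at 1/z becomes, up to such factors, B = z P_n' - z
r P_n - (n - θ) P_n.

The core is one integration by parts, `hasCircleMean_darboux`. The equation of P_n and the Riccati
equation of r show that z d/dz of z^(-n) (1-z) w P_m B is z^(-n) z (1-z) w A B minus (n - θ) z^(-n)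
w P_m Q, with Q = `hrDual n α β`. On the circle w has its only singularity at z = 1, where the
boundary term vanishes, so the exceptional pairing is (n - θ) times the ordinary one.

Off the diagonal the ordinary pairing is the mean of an exact derivative
(`hasCircleMean_hrDual_of_ne`). On the diagonal the same integration by parts with the trivial seed
φ = 1 lowers n and raises α (`hasCircleMean_hrDual_self`), down to the mean of w. That mean is h_0
(`hrMean_eq_hrNorm`): contiguity relations and Laplace's method compare it with the mean of
(1-z)^(α+β), which is 1 by the mean value property.

For the extra state of type four, w^(4,l) P and w^(4,l) Q are themselves exact derivatives on the
circle. -/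

noncomputable section

/-! ### Hypergeometric polynomials: coefficients, differential equation, reciprocal. -/

section HypergeometricPolynomials

open Polynomial in
/-- The polynomial `∑ k, (n choose k) (α + 1)_k (β)_{n - k} / (α + 1)_n * X ^ k`. -/
def hrPolynomial (n : ℕ) (α β : ℝ) : ℂ[X] :=
  ∑ k ∈ Finset.range (n + 1), monomial k
    ((n.choose k * (ascPochhammer ℝ k).eval (α + 1) * (ascPochhammer ℝ (n - k)).eval β /
      (ascPochhammer ℝ n).eval (α + 1) : ℝ) : ℂ)

theorem hrPolynomial_coeff (n k : ℕ) (α β : ℝ) :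
    (hrPolynomial n α β).coeff k =
      ((n.choose k * (ascPochhammer ℝ k).eval (α + 1) * (ascPochhammer ℝ (n - k)).eval β /
        (ascPochhammer ℝ n).eval (α + 1) : ℝ) : ℂ) := by
  simp only [hrPolynomial, Polynomial.finsetSum_coeff, Polynomial.coeff_monomial,
    Finset.sum_ite_eq', Finset.mem_range]
  split_ifs with h
  · rfl
  · simp [Nat.choose_eq_zero_of_lt (by omega : n < k)]

theorem hrPolynomial_eval (n : ℕ) (α β : ℝ) (z : ℂ) :
    (hrPolynomial n α β).eval z = ∑ k ∈ Finset.range (n + 1),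
      ((n.choose k * (ascPochhammer ℝ k).eval (α + 1) * (ascPochhammer ℝ (n - k)).eval β /
        (ascPochhammer ℝ n).eval (α + 1) : ℝ) : ℂ) * z ^ k := by
  simp [hrPolynomial, Polynomial.eval_finsetSum]

theorem ascPochhammer_eval_ne_zero {n : ℕ} {a : ℝ} (h : ∀ k < n, a + k ≠ 0) :
    (ascPochhammer ℝ n).eval a ≠ 0 := by
  rw [Ne, ascPochhammer_eval_eq_zero_iff]
  rintro ⟨k, hk, h'⟩
  exact h k hk (by rw [h']; ring)

theorem ascPochhammer_eval_succ_left (n : ℕ) (a : ℝ) :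
    (ascPochhammer ℝ (n + 1)).eval a = a * (ascPochhammer ℝ n).eval (a + 1) := by
  simp [ascPochhammer_succ_left]

theorem ascPochhammer_eval_reflect (b : ℝ) (n : ℕ) {k : ℕ} (hk : k ≤ n) :
    (ascPochhammer ℝ k).eval (1 - b - n) * (ascPochhammer ℝ (n - k)).eval b =
      (-1) ^ k * (ascPochhammer ℝ n).eval b := by
  induction k with
  | zero => simp
  | succ k ih =>
    have ih := ih (by omega)
    obtain ⟨m, rfl⟩ : ∃ m, n = k + 1 + m := ⟨n - (k + 1), by omega⟩
    rw [show k + 1 + m - k = m + 1 by omega, ascPochhammer_succ_eval m] at ih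
    rw [show k + 1 + m - (k + 1) = m by omega, ascPochhammer_succ_eval k, pow_succ]
    push_cast at ih ⊢
    linear_combination (-1) * ih

/-- The reflection (1-β-n)_k (β)_(n-k) = (-1)^k (β)_n moves the lower parameter into the numerator.
Since (β)_n ≠ 0, no denominator of the series vanishes for k ≤ n, and (-n)_k = 0 ends the series
afterwards. -/
theorem hrPoly_eq_eval {n : ℕ} {α β : ℝ} (hβ : ∀ k < n, β + k ≠ 0) (z : ℂ) :
    hrPoly n α β z = (hrPolynomial n α β).eval z := by
  rw [hrPoly, ordinaryHypergeometric_eq_tsum]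
  dsimp only
  rw [tsum_eq_sum (s := Finset.range (n + 1)),
    hrPolynomial_eval, Finset.mul_sum]
  · refine Finset.sum_congr rfl fun k hk => ?_
    have hk : k ≤ n := by simpa [Nat.lt_succ_iff] using hk
    have h1 := ascPochhammer_eval_reflect β n hk
    have h2 := ascPochhammer_eval_reflect 1 n hk
    rw [show (1 : ℝ) - 1 - n = -n by ring] at h2
    have hb := ascPochhammer_eval_ne_zero hβ
    have hc : (ascPochhammer ℝ k).eval (1 - β - n) ≠ 0 := by
      intro h
      rw [h, zero_mul] at h1
      exact mul_ne_zero (pow_ne_zero k (by norm_num)) hb h1.symm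
    rw [ascPochhammer_eval_one, ascPochhammer_eval_one] at h2
    have hf : (n.choose k : ℝ) * k.factorial * (n - k).factorial = n.factorial := by
      exact_mod_cast Nat.choose_mul_factorial_mul_factorial hk
    have hk0 : (k.factorial : ℝ) ≠ 0 := by positivity
    have hnk0 : ((n - k).factorial : ℝ) ≠ 0 := by positivity
    have key : (ascPochhammer ℝ n).eval β * (ascPochhammer ℝ k).eval (-(n : ℝ)) =
        n.choose k * k.factorial * (ascPochhammer ℝ (n - k)).eval β *
          (ascPochhammer ℝ k).eval (1 - β - n) := by
      refine mul_right_cancel₀ (b := (-1 : ℝ) ^ k * (n - k).factorial)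
        (mul_ne_zero (pow_ne_zero k (by norm_num)) hnk0) ?_
      linear_combination (-1 : ℝ) ^ k * (ascPochhammer ℝ n).eval β * h2 -
        (-1 : ℝ) ^ k * n.factorial * h1 - (-1 : ℝ) ^ k * (ascPochhammer ℝ (n - k)).eval β *
          (ascPochhammer ℝ k).eval (1 - β - n) * hf
    rw [Complex.real_smul, ← mul_assoc, ← Complex.ofReal_mul]
    congr 2
    have key' : (ascPochhammer ℝ n).eval β * (ascPochhammer ℝ k).eval (-(n : ℝ)) *
        (k.factorial : ℝ)⁻¹ * ((ascPochhammer ℝ k).eval (1 - β - n))⁻¹ =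
        n.choose k * (ascPochhammer ℝ (n - k)).eval β := by
      field_simp
      linear_combination key
    -- The inverse of (α+1)_n is a common factor, so its vanishing (inverse 0) need not be excluded.
    simp only [div_eq_mul_inv]
    linear_combination (ascPochhammer ℝ k).eval (α + 1) *
      ((ascPochhammer ℝ n).eval (α + 1))⁻¹ * key'
  · intro k hk
    have hk : n < k := by simpa [Nat.lt_succ_iff] using hk
    simp [ascPochhammer_eval_neg_coe_nat_of_lt hk]

open Polynomial in
theorem derivative_hrPolynomial {n : ℕ} {α : ℝ} (hα : ∀ k < n, α + 1 + k ≠ 0) (β : ℝ) :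
    derivative (hrPolynomial n α β) = (n : ℂ[X]) * hrPolynomial (n - 1) (α + 1) β := by
  ext k
  rw [coeff_derivative, ← C_eq_natCast, coeff_C_mul, hrPolynomial_coeff, hrPolynomial_coeff]
  rcases n with _ | n
  · simp
  have h1 : ((n + 1 : ℕ) : ℝ) * n.choose k = (n + 1).choose (k + 1) * (k + 1 : ℕ) := by
    exact_mod_cast Nat.add_one_mul_choose_eq n k
  have h0 := ascPochhammer_eval_ne_zero hα
  rw [ascPochhammer_eval_succ_left] at h0
  rw [ascPochhammer_eval_succ_left, ascPochhammer_eval_succ_left,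
    show n + 1 - (k + 1) = n - k by omega, show n + 1 - 1 = n by omega]
  norm_cast
  rw [div_mul_eq_mul_div, mul_div_assoc', div_eq_div_iff h0 (right_ne_zero_of_mul h0)]
  linear_combination (-1) * (α + 1) * (ascPochhammer ℝ k).eval (α + 1 + 1) *
    (ascPochhammer ℝ (n - k)).eval β * (ascPochhammer ℝ n).eval (α + 1 + 1) * h1

open Polynomial in
theorem coeff_X_mul_derivative (p : ℂ[X]) (k : ℕ) :
    (X * derivative p).coeff k = k * p.coeff k := by
  rcases k with _ | k
  · simp
  · rw [coeff_X_mul, coeff_derivative]; push_cast; ring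

open Polynomial in
-- Rests on (n - k) binom(n, k) = n binom(n - 1, k). This is the counterpart of the derivative
-- formula under z ↦ 1/z; it accounts for the terms with second parameter raised in types three and
-- four.
theorem natCast_mul_hrPolynomial_sub (n : ℕ) (α β : ℝ) :
    (n : ℂ[X]) * hrPolynomial n α β - X * derivative (hrPolynomial n α β) =
      C (n * β / (α + n) : ℂ) * hrPolynomial (n - 1) α (β + 1) := by
  ext k
  rw [coeff_sub, coeff_X_mul_derivative, ← C_eq_natCast, coeff_C_mul, coeff_C_mul, hrPolynomial_coeff,
    hrPolynomial_coeff]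
  rcases n with _ | n
  · rcases k with _ | k <;> simp
  rw [Nat.add_sub_cancel]
  rcases Nat.lt_or_ge n k with hk | hk
  · rcases Nat.lt_or_ge (n + 1) k with hk' | hk'
    · simp [Nat.choose_eq_zero_of_lt hk, Nat.choose_eq_zero_of_lt hk']
    · obtain rfl : k = n + 1 := by omega
      simp
  · obtain ⟨d, rfl⟩ := Nat.exists_eq_add_of_le hk
    have h1 : ((k + d + 1 : ℕ) : ℝ) * (k + d).choose k = (k + d + 1).choose k * (d + 1 : ℕ) := by
      have := Nat.choose_mul_succ_eq (k + d) k
      rw [show k + d + 1 - k = d + 1 by omega] at this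
      rw [mul_comm]
      exact_mod_cast this
    rw [show k + d + 1 - k = d + 1 by omega, show k + d - k = d by omega,
      ascPochhammer_eval_succ_left d, ascPochhammer_succ_eval (k + d)]
    have h2 : α + 1 + ((k + d : ℕ) : ℝ) = α + ((k + d + 1 : ℕ) : ℝ) := by push_cast; ring
    rw [h2]
    have h3 : (((k + d + 1 : ℕ) : ℂ) * β / (α + ((k + d + 1 : ℕ) : ℂ)) : ℂ) =
      (((k + d + 1 : ℕ) * β / (α + ((k + d + 1 : ℕ) : ℝ)) : ℝ) : ℂ) := by push_cast; rfl
    have h4 : (((k + d + 1 : ℕ) : ℂ)) = (((k + d + 1 : ℕ) : ℝ) : ℂ) := by norm_cast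
    have h5 : (k : ℂ) = ((k : ℝ) : ℂ) := by norm_cast
    rw [h3, h4, h5, ← Complex.ofReal_mul, ← Complex.ofReal_mul, ← Complex.ofReal_mul,
      ← Complex.ofReal_sub]
    congr 1
    have h6 : ((k + d + 1 : ℕ) : ℝ) - k = (d + 1 : ℕ) := by push_cast; ring
    rw [← sub_mul, h6]
    simp only [div_eq_mul_inv, mul_inv]
    linear_combination (-1) * (ascPochhammer ℝ k).eval (α + 1) * β *
      (ascPochhammer ℝ d).eval (β + 1) * ((ascPochhammer ℝ (k + d)).eval (α + 1))⁻¹ *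
      (α + ((k + d + 1 : ℕ) : ℝ))⁻¹ * h1

open Polynomial in
/-- The coefficients satisfy the two-term recurrence equivalent to the hypergeometric equation. -/
theorem hrPolynomial_coeff_succ (n k : ℕ) (α β : ℝ) :
    ((k : ℂ) + 1) * (n - k - 1 + β) * (hrPolynomial n α β).coeff (k + 1) =
      ((n : ℂ) - k) * (α + 1 + k) * (hrPolynomial n α β).coeff k := by
  rw [hrPolynomial_coeff, hrPolynomial_coeff]
  rcases Nat.lt_or_ge k n with hk | hk
  · obtain ⟨d, rfl⟩ := Nat.exists_eq_add_of_lt hk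
    have h1 : ((k + d + 1).choose (k + 1) : ℂ) * (k + 1) = (k + d + 1).choose k * (d + 1) := by
      have := Nat.choose_succ_right_eq (k + d + 1) k
      rw [show k + d + 1 - k = d + 1 by omega] at this
      exact_mod_cast this
    rw [show k + d + 1 - k = d + 1 by omega, show k + d + 1 - (k + 1) = d by omega,
      ascPochhammer_succ_eval k, ascPochhammer_succ_eval d]
    push_cast
    simp only [div_eq_mul_inv]
    linear_combination (((ascPochhammer ℝ k).eval (α + 1) : ℝ) : ℂ) * (α + 1 + k) *
      (((ascPochhammer ℝ d).eval β : ℝ) : ℂ) * (d + β) *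
      (((ascPochhammer ℝ (k + d + 1)).eval (α + 1) : ℝ) : ℂ)⁻¹ * h1
  · rw [Nat.choose_eq_zero_of_lt (by omega : n < k + 1)]
    rcases hk.eq_or_lt with rfl | hk
    · simp
    · simp [Nat.choose_eq_zero_of_lt hk]

open Polynomial in
/-- The hypergeometric differential equation. -/
theorem hrPolynomial_ode (n : ℕ) (α β : ℝ) (z : ℂ) :
    z * (1 - z) * (derivative (derivative (hrPolynomial n α β))).eval z +
      (1 - β - n - (α + 2 - n) * z) * (derivative (hrPolynomial n α β)).eval z +
      n * (α + 1) * (hrPolynomial n α β).eval z = 0 := by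
  set p := hrPolynomial n α β with hp
  have h : C ((n : ℂ) - 1 + β) * derivative p - X * derivative (derivative p) =
      C ((n : ℂ) * (α + 1)) * p + C ((n : ℂ) - (α + 1)) * (X * derivative p) -
        X * derivative (X * derivative p) := by
    ext k
    simp only [coeff_add, coeff_sub, coeff_C_mul, coeff_X_mul_derivative, coeff_derivative]
    have := hrPolynomial_coeff_succ n k α β
    rw [← hp] at this
    linear_combination this
  have h' := congrArg (eval z) h
  simp only [eval_add, eval_sub, eval_mul, eval_C, eval_X, derivative_mul, derivative_X,
    one_mul] at h'
  linear_combination -h'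

/-- Passing to the reciprocal polynomial exchanges `(α, β)` and `(β - 1, α + 1)`. -/
theorem hrPolynomial_eval_inv {n : ℕ} {α : ℝ} (hα : ∀ k < n, α + 1 + k ≠ 0) (β : ℝ) {z : ℂ}
    (hz : z ≠ 0) :
    (hrPolynomial n (β - 1) (α + 1)).eval z⁻¹ =
      (((ascPochhammer ℝ n).eval (α + 1) / (ascPochhammer ℝ n).eval β : ℝ) : ℂ) * (z ^ n)⁻¹ *
        (hrPolynomial n α β).eval z := by
  rw [hrPolynomial_eval, hrPolynomial_eval, ← Finset.sum_range_reflect, Finset.mul_sum]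
  refine Finset.sum_congr rfl fun k hk => ?_
  obtain ⟨d, rfl⟩ := Nat.exists_eq_add_of_le (Nat.lt_succ_iff.mp (Finset.mem_range.mp hk))
  have h0 := ascPochhammer_eval_ne_zero hα
  rw [show k + d + 1 - 1 - k = d by omega, show k + d - d = k by omega,
    show k + d - k = d by omega, sub_add_cancel, Nat.choose_symm_add]
  have h1 : (z⁻¹) ^ d = (z ^ (k + d))⁻¹ * z ^ k := by
    rw [pow_add, inv_pow]; field_simp
  rw [h1]
  have h2 : ∀ x y c Z W : ℂ, x = c * y → x * (Z * W) = c * Z * (y * W) := by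
    intro x y c Z W h; rw [h]; ring
  refine h2 _ _ _ _ _ ?_
  rw [← Complex.ofReal_mul]
  congr 1
  field_simp

end HypergeometricPolynomials

/-! ### Means over the unit circle and exact derivatives. -/

section CircleMean

open Filter Topology

/-- `f` is integrable on the unit circle, with mean value `c`. -/
def HasCircleMean (f : ℂ → ℂ) (c : ℂ) : Prop :=
  CircleIntegrable f 0 1 ∧ Real.circleAverage f 0 1 = c

/-- The unit circle without the point `1`. -/
def puncturedCircle : Set ℂ := {z | ‖z‖ = 1 ∧ z ≠ 1}

theorem circleMap_mem_puncturedCircle {θ : ℝ} (h : θ ∈ Set.Ioo 0 (2 * Real.pi)) :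
    circleMap 0 1 θ ∈ puncturedCircle := by
  refine ⟨by simp, fun h1 => ?_⟩
  have h2 : circleMap 0 1 θ = Complex.exp (θ * Complex.I) := by simp [circleMap]
  rw [h2] at h1
  have h3 := (Complex.norm_exp_I_mul_ofReal_sub_one θ)
  rw [mul_comm, h1, sub_self, norm_zero] at h3
  have h4 : 0 < Real.sin (θ / 2) :=
    Real.sin_pos_of_pos_of_lt_pi (by linarith [h.1]) (by linarith [h.2])
  have h5 := norm_eq_zero.mp h3.symm
  linarith

theorem norm_one_sub_circleMap (θ : ℝ) : ‖1 - circleMap 0 1 θ‖ = |2 * Real.sin (θ / 2)| := by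
  have h2 : circleMap 0 1 θ = Complex.exp (Complex.I * θ) := by simp [circleMap, mul_comm]
  rw [h2, norm_sub_rev, Complex.norm_exp_I_mul_ofReal_sub_one, Real.norm_eq_abs]

theorem ne_zero_of_mem_puncturedCircle {z : ℂ} (hz : z ∈ puncturedCircle) : z ≠ 0 :=
  norm_ne_zero_iff.mp (by rw [hz.1]; exact one_ne_zero)

theorem one_sub_ne_zero_of_mem_puncturedCircle {z : ℂ} (hz : z ∈ puncturedCircle) : 1 - z ≠ 0 :=
  sub_ne_zero.mpr hz.2.symm

namespace HasCircleMean

/-- The point 1 corresponds only to the endpoints of the parameter interval, so identities are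
needed only where the principal powers are holomorphic. -/
theorem congr {f g : ℂ → ℂ} {c : ℂ} (hf : HasCircleMean f c)
    (h : ∀ z ∈ puncturedCircle, f z = g z) : HasCircleMean g c := by
  have h' : Set.EqOn (fun θ => f (circleMap 0 1 θ)) (fun θ => g (circleMap 0 1 θ))
      (Set.uIoo 0 (2 * Real.pi)) := by
    intro θ hθ
    rw [Set.uIoo_of_le Real.two_pi_pos.le] at hθ
    exact h _ (circleMap_mem_puncturedCircle hθ)
  refine ⟨IntervalIntegrable.congr_uIoo hf.1 h', ?_⟩
  rw [← hf.2, Real.circleAverage_def, Real.circleAverage_def]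
  exact congrArg _ (intervalIntegral.integral_congr_uIoo h').symm

theorem add {f g : ℂ → ℂ} {c d : ℂ} (hf : HasCircleMean f c) (hg : HasCircleMean g d) :
    HasCircleMean (fun z => f z + g z) (c + d) :=
  ⟨hf.1.add hg.1, by rw [← hf.2, ← hg.2]; exact Real.circleAverage_add hf.1 hg.1⟩

theorem const_mul {f : ℂ → ℂ} {c : ℂ} (a : ℂ) (hf : HasCircleMean f c) :
    HasCircleMean (fun z => a * f z) (a * c) :=
  ⟨IntervalIntegrable.const_mul hf.1 a, by rw [← hf.2]; exact Real.circleAverage_fun_smul (a := a)⟩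

theorem unique {f : ℂ → ℂ} {c d : ℂ} (hf : HasCircleMean f c) (hg : HasCircleMean f d) : c = d :=
  hf.2.symm.trans hg.2

end HasCircleMean

theorem CircleIntegrable.hasCircleMean {f : ℂ → ℂ} (hf : CircleIntegrable f 0 1) :
    HasCircleMean f (Real.circleAverage f 0 1) := ⟨hf, rfl⟩

/-- A function of moderate growth at `1` that is the derivative along the circle of a function
tending to zero at `1` has mean value zero. -/
theorem hasCircleMean_zero_of_hasDerivAt {F f : ℂ → ℂ} (hf : CircleIntegrable f 0 1)
    (hF : ∀ z ∈ puncturedCircle, HasDerivAt F (f z / z) z)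
    (h0 : Tendsto F (𝓝[puncturedCircle] 1) (𝓝 0)) : HasCircleMean f 0 := by
  refine ⟨hf, ?_⟩
  have hlim : ∀ {l : Filter ℝ} {a : ℝ}, circleMap 0 1 a = 1 → l ≤ 𝓝 a →
      (∀ᶠ θ in l, θ ∈ Set.Ioo 0 (2 * Real.pi)) →
      Tendsto (fun θ => F (circleMap 0 1 θ)) l (𝓝 0) := by
    intro l a ha hl hθ
    refine h0.comp (tendsto_nhdsWithin_iff.mpr ⟨?_, ?_⟩)
    · rw [← ha]
      exact ((continuous_circleMap 0 1).tendsto a).mono_left hl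
    · exact hθ.mono fun θ h => circleMap_mem_puncturedCircle h
  -- Along the circle d/dθ = i z d/dz, which cancels the division by z in the hypothesis. Both ends
  -- of the interval map to 1, where F tends to 0.
  have key := intervalIntegral.integral_eq_sub_of_hasDerivAt_of_tendsto
    (f := fun θ => F (circleMap 0 1 θ)) (f' := fun θ => Complex.I * f (circleMap 0 1 θ))
    Real.two_pi_pos (fun θ hθ => ?_) (IntervalIntegrable.const_mul hf Complex.I)
    (hlim (by simp [circleMap]) nhdsWithin_le_nhds (Ioo_mem_nhdsGT Real.two_pi_pos))
    (hlim (by simp [circleMap]) nhdsWithin_le_nhds (Ioo_mem_nhdsLT Real.two_pi_pos))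
  · rw [intervalIntegral.integral_const_mul, sub_self] at key
    rw [Real.circleAverage_def, (mul_eq_zero.mp key).resolve_left Complex.I_ne_zero, smul_zero]
  · have hz := circleMap_mem_puncturedCircle hθ
    have := (hF _ hz).comp θ (hasDerivAt_circleMap 0 1 θ)
    refine HasDerivAt.congr_deriv (f := fun θ => F (circleMap 0 1 θ)) this ?_
    have := ne_zero_of_mem_puncturedCircle hz
    field_simp

/-- Jordan's inequality bounds |1 - e^(iθ)| = 2 |sin(θ/2)| below by (2/π) min(θ, 2π - θ). For s ≤ 0
this gives two integrable power singularities; positive s reduces to s = 0 because |1 - z| ≤ 2. -/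
theorem circleIntegrable_of_norm_le {f : ℂ → ℂ} {C s : ℝ} (hC : 0 ≤ C) (hs : -1 < s)
    (hf : ContinuousOn f puncturedCircle)
    (hbound : ∀ z ∈ puncturedCircle, ‖f z‖ ≤ C * ‖1 - z‖ ^ s) : CircleIntegrable f 0 1 := by
  wlog hs0 : s ≤ 0 generalizing C s
  · refine this (C := C * 2 ^ s) (s := 0) (by positivity) (by norm_num) (fun z hz => ?_) le_rfl
    rw [Real.rpow_zero, mul_one]
    refine (hbound z hz).trans ?_
    gcongr
    · linarith
    · calc ‖1 - z‖ ≤ ‖(1 : ℂ)‖ + ‖z‖ := norm_sub_le _ _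
        _ = 2 := by rw [hz.1, norm_one]; norm_num
  set g : ℝ → ℝ := fun θ => C * ((2 / Real.pi) ^ s * (θ ^ s + (2 * Real.pi - θ) ^ s)) with hg
  have hgi : IntervalIntegrable g MeasureTheory.volume 0 (2 * Real.pi) := by
    have h1 : IntervalIntegrable (fun θ : ℝ => θ ^ s) MeasureTheory.volume 0 (2 * Real.pi) :=
      intervalIntegral.intervalIntegrable_rpow' hs
    have h2 := h1.comp_sub_left (2 * Real.pi)
    rw [sub_zero, sub_self] at h2
    exact ((h1.add h2.symm).const_mul _).const_mul _
  refine IntervalIntegrable.mono_fun' hgi ?_ ?_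
  · rw [Set.uIoc_of_le Real.two_pi_pos.le, ← MeasureTheory.restrict_Ioo_eq_restrict_Ioc]
    exact (hf.comp (continuous_circleMap 0 1).continuousOn
      fun θ hθ => circleMap_mem_puncturedCircle hθ).aestronglyMeasurable measurableSet_Ioo
  · rw [Set.uIoc_of_le Real.two_pi_pos.le, ← MeasureTheory.restrict_Ioo_eq_restrict_Ioc]
    refine MeasureTheory.ae_restrict_of_forall_mem measurableSet_Ioo fun θ hθ => ?_
    refine (hbound _ (circleMap_mem_puncturedCircle hθ)).trans ?_
    rw [norm_one_sub_circleMap]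
    refine mul_le_mul_of_nonneg_left ?_ hC
    have hp := Real.pi_pos
    have hθ1 := hθ.1
    have hθ2 : 0 < 2 * Real.pi - θ := by linarith [hθ.2]
    rw [mul_add, ← Real.mul_rpow (by positivity) hθ1.le, ← Real.mul_rpow (by positivity) hθ2.le]
    rcases le_total θ Real.pi with h | h
    · have h1 := Real.mul_le_sin (x := θ / 2) (by linarith) (by linarith)
      have h2 : 2 / Real.pi * θ ≤ |2 * Real.sin (θ / 2)| := by
        refine le_trans ?_ (le_abs_self _)
        linarith
      exact (Real.rpow_le_rpow_of_nonpos (by positivity) h2 hs0).trans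
        (le_add_of_nonneg_right (by positivity))
    · have h1 := Real.mul_le_sin (x := Real.pi - θ / 2) (by linarith) (by linarith)
      rw [Real.sin_pi_sub] at h1
      have h2 : 2 / Real.pi * (2 * Real.pi - θ) ≤ |2 * Real.sin (θ / 2)| := by
        refine le_trans ?_ (le_abs_self _)
        linarith
      exact (Real.rpow_le_rpow_of_nonpos (by positivity) h2 hs0).trans
        (le_add_of_nonneg_left (by positivity))

/-! ### The weight on the punctured circle: derivative, modulus, contiguity. -/

section Weight

variable {α β : ℝ} {z : ℂ}

theorem one_sub_mem_slitPlane (hz : z ∈ puncturedCircle) : 1 - z ∈ Complex.slitPlane := by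
  have h1 : z.re ≤ 1 := (Complex.re_le_norm z).trans hz.1.le
  left
  rw [Complex.sub_re, Complex.one_re]
  refine lt_of_le_of_ne (by linarith) fun h => hz.2 ?_
  have h2 := Complex.sq_norm z
  rw [hz.1, Complex.normSq_apply, show z.re = 1 by linarith] at h2
  exact Complex.ext (by simp; linarith) (by simp; nlinarith)

theorem neg_mem_slitPlane (hz : z ∈ puncturedCircle) : -z ∈ Complex.slitPlane := by
  rw [Complex.mem_slitPlane_iff, Complex.neg_re, Complex.neg_im]
  by_contra! h
  have h2 := Complex.sq_norm z
  have h3 : z.im = 0 := by linarith [h.2]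
  rw [hz.1, Complex.normSq_apply, h3] at h2
  exact hz.2 (Complex.ext (by simp; nlinarith [h.1]) (by simp [h3]))

theorem hasDerivAt_hrWeight (α β : ℝ) (hz : z ∈ puncturedCircle) :
    HasDerivAt (hrWeight α β) (hrWeight α β z * (-β / z - (α + β) / (1 - z))) z := by
  have h0 := ne_zero_of_mem_puncturedCircle hz
  have h1 := one_sub_ne_zero_of_mem_puncturedCircle hz
  have hA := ((hasDerivAt_id z).neg).cpow_const (c := -(β : ℂ)) (neg_mem_slitPlane hz)
  have hB := ((hasDerivAt_id z).const_sub 1).cpow_const (c := (α : ℂ) + β)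
    (one_sub_mem_slitPlane hz)
  refine HasDerivAt.congr_deriv (f := hrWeight α β) (hA.mul hB) ?_
  simp only [hrWeight, id, Pi.neg_apply, Complex.cpow_sub _ _ (neg_ne_zero.mpr h0), Complex.cpow_sub _ _ h1,
    Complex.cpow_one]
  field_simp
  ring

theorem norm_hrWeight (α β : ℝ) (hz : z ∈ puncturedCircle) :
    ‖hrWeight α β z‖ = ‖1 - z‖ ^ (α + β) := by
  rw [hrWeight, norm_mul, ← Complex.ofReal_neg, ← Complex.ofReal_add, Complex.norm_cpow_real,
    Complex.norm_cpow_real, norm_neg, hz.1, Real.one_rpow, one_mul]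

theorem one_sub_mul_hrWeight (α β : ℝ) (hz : z ∈ puncturedCircle) :
    (1 - z) * hrWeight α β z = hrWeight (α + 1) β z := by
  have h1 := one_sub_ne_zero_of_mem_puncturedCircle hz
  rw [hrWeight, hrWeight, show ((α + 1 : ℝ) : ℂ) + β = (α + β) + 1 by push_cast; ring,
    Complex.cpow_add ((α : ℂ) + β) 1 h1, Complex.cpow_one]
  ring

theorem hrWeight_add_one_right (α β : ℝ) (hz : z ∈ puncturedCircle) :
    hrWeight α (β + 1) z = (1 - z⁻¹) * hrWeight α β z := by
  have h0 := ne_zero_of_mem_puncturedCircle hz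
  have h1 := one_sub_ne_zero_of_mem_puncturedCircle hz
  rw [hrWeight, hrWeight, show (α : ℂ) + ((β + 1 : ℝ) : ℂ) = (α + β) + 1 by push_cast; ring,
    Complex.cpow_add ((α : ℂ) + β) 1 h1, Complex.cpow_one,
    show -((β + 1 : ℝ) : ℂ) = -β - 1 by push_cast; ring,
    Complex.cpow_sub _ _ (neg_ne_zero.mpr h0), Complex.cpow_one]
  field_simp
  ring

theorem isCompact_unit_circle : IsCompact {z : ℂ | ‖z‖ = 1} := by
  have : {z : ℂ | ‖z‖ = 1} = Metric.sphere 0 1 := by ext; simp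
  rw [this]
  exact isCompact_sphere 0 1

theorem exists_norm_le_of_continuousOn {g : ℂ → ℂ} (hg : ContinuousOn g {z | ‖z‖ = 1}) :
    ∃ C, 0 ≤ C ∧ ∀ z, ‖z‖ = 1 → ‖g z‖ ≤ C := by
  obtain ⟨C, hC⟩ := isCompact_unit_circle.exists_bound_of_continuousOn hg
  exact ⟨C, (norm_nonneg _).trans (hC 1 (by simp)), hC⟩

theorem continuousOn_hrWeight (α β : ℝ) : ContinuousOn (hrWeight α β) puncturedCircle :=
  fun _ hz => (hasDerivAt_hrWeight α β hz).continuousAt.continuousWithinAt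

theorem circleIntegrable_hrWeight_mul (h : -1 < α + β) {g : ℂ → ℂ}
    (hg : ContinuousOn g {z | ‖z‖ = 1}) :
    CircleIntegrable (fun z => hrWeight α β z * g z) 0 1 := by
  obtain ⟨C, hC0, hC⟩ := exists_norm_le_of_continuousOn hg
  refine circleIntegrable_of_norm_le hC0 h
    ((continuousOn_hrWeight α β).mul (hg.mono fun z hz => hz.1)) fun z hz => ?_
  rw [norm_mul, norm_hrWeight α β hz, mul_comm]
  exact mul_le_mul_of_nonneg_right (hC z hz.1) (by positivity)

theorem tendsto_hrWeight_mul (h : 0 < α + β) {g : ℂ → ℂ}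
    (hg : ContinuousOn g {z | ‖z‖ = 1}) :
    Tendsto (fun z => hrWeight α β z * g z) (𝓝[puncturedCircle] 1) (𝓝 0) := by
  obtain ⟨C, hC0, hC⟩ := exists_norm_le_of_continuousOn hg
  have hlim : Tendsto (fun z : ℂ => ‖1 - z‖ ^ (α + β) * C) (𝓝[puncturedCircle] 1) (𝓝 0) := by
    have : Continuous fun z : ℂ => ‖1 - z‖ ^ (α + β) * C :=
      ((Real.continuous_rpow_const h.le).comp (by fun_prop)).mul continuous_const
    have := (this.tendsto 1).mono_left (nhdsWithin_le_nhds (s := puncturedCircle))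
    simpa [Real.zero_rpow h.ne'] using this
  refine squeeze_zero_norm' ?_ hlim
  filter_upwards [self_mem_nhdsWithin] with z hz
  rw [norm_mul, norm_hrWeight α β hz]
  exact mul_le_mul_of_nonneg_left (hC z hz.1) (by positivity)

end Weight

theorem hasCirclePairing_of_hasCircleMean {w P Q : ℂ → ℂ} {c : ℂ}
    (h : HasCircleMean (fun z => w z * P z * Q z⁻¹) c) : HasCirclePairing w P Q c := by
  have h1 : (fun x : ℝ => w (Complex.exp (Complex.I * x)) * P (Complex.exp (Complex.I * x)) *
      Q (Complex.exp (-(Complex.I * x)))) =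
      fun θ => (fun z => w z * P z * Q z⁻¹) (circleMap 0 1 θ) := by
    funext x
    simp [circleMap, Complex.exp_neg, mul_comm Complex.I]
  obtain ⟨hi, hc⟩ := h
  rw [HasCirclePairing, h1]
  refine ⟨hi, ?_⟩
  rw [← hc, Real.circleAverage_def, Complex.real_smul]
  simp

end CircleMean

/-! ### The constant h_n and the mean of the weight. -/

section NormalizationConstant

open Filter Topology

theorem hrNorm_factor_eq (n k : ℕ) {α β : ℝ} (h : -1 < α + β) :
    ((α + n + 1 + k) * (β + n + 1 + k)) / (((n : ℝ) + 1 + k) * (α + β + n + 1 + k)) =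
      1 + α * β / (((n : ℝ) + 1 + k) * (α + β + n + 1 + k)) := by
  have h1 : ((n : ℝ) + 1 + k) ≠ 0 := by positivity
  have h2 : α + β + n + 1 + k ≠ 0 := by
    have : 0 < α + β + 1 := by linarith
    have : 0 < (α + β + 1) + n + k := by positivity
    linarith
  rw [div_eq_iff (mul_ne_zero h1 h2), add_mul 1, div_mul_cancel₀ _ (mul_ne_zero h1 h2)]
  ring

theorem tendsto_prod_hrNorm (n : ℕ) {α β : ℝ} (h : -1 < α + β) :
    Tendsto (fun N => ∏ k ∈ Finset.range N,
      ((α + n + 1 + k) * (β + n + 1 + k)) / (((n : ℝ) + 1 + k) * (α + β + n + 1 + k)))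
      atTop (𝓝 (hrNorm n α β)) := by
  refine Multipliable.tendsto_prod_tprod_nat ?_
  simp only [hrNorm_factor_eq n _ h]
  refine Real.multipliable_one_add_of_summable ?_
  -- Chosen so that α + β + n + 1 + k ≥ δ (k + 1) for all n and k, giving a majorant of order (k +
  -- 1)^(-2).
  set δ := min 1 (α + β + 1) with hδ
  have hδ0 : 0 < δ := lt_min one_pos (by linarith)
  have hS : Summable fun k : ℕ => |α * β| / δ * (1 / ((k + 1 : ℕ) : ℝ) ^ 2) :=
    ((summable_nat_add_iff 1).mpr (Real.summable_one_div_nat_pow.mpr one_lt_two)).mul_left _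
  refine Summable.of_norm_bounded hS fun k => ?_
  have h1 : ((k + 1 : ℕ) : ℝ) ≤ (n : ℝ) + 1 + k := by
    push_cast; linarith [(Nat.cast_nonneg n : (0 : ℝ) ≤ n)]
  have h2 : δ * ((k + 1 : ℕ) : ℝ) ≤ α + β + n + 1 + k := by
    have hk : (0 : ℝ) ≤ k := Nat.cast_nonneg k
    have hn : (0 : ℝ) ≤ n := Nat.cast_nonneg n
    have := min_le_left 1 (α + β + 1)
    have := min_le_right 1 (α + β + 1)
    push_cast
    nlinarith
  have h3 : (0 : ℝ) < ((k + 1 : ℕ) : ℝ) := by positivity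
  have h4 : 0 < ((n : ℝ) + 1 + k) * (α + β + n + 1 + k) :=
    mul_pos (h3.trans_le h1) ((mul_pos hδ0 h3).trans_le h2)
  rw [norm_div, Real.norm_eq_abs, Real.norm_eq_abs, abs_of_pos h4, div_mul_div_comm, mul_one]
  refine div_le_div_of_nonneg_left (abs_nonneg _) (by positivity) ?_
  calc δ * ((k + 1 : ℕ) : ℝ) ^ 2 = ((k + 1 : ℕ) : ℝ) * (δ * ((k + 1 : ℕ) : ℝ)) := by ring
    _ ≤ _ := mul_le_mul h1 h2 (by positivity) (by positivity)

theorem tendsto_add_natCast_div (a b : ℝ) :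
    Tendsto (fun N : ℕ => (a + N) / (b + N)) atTop (𝓝 1) := by
  have h1 : Tendsto (fun N : ℕ => b + (N : ℝ)) atTop atTop :=
    tendsto_atTop_add_const_left _ _ tendsto_natCast_atTop_atTop
  have h2 : Tendsto (fun N : ℕ => 1 + (a - b) / (b + (N : ℝ))) atTop (𝓝 (1 + 0)) :=
    tendsto_const_nhds.add (h1.const_div_atTop _)
  rw [add_zero] at h2
  refine h2.congr' ?_
  filter_upwards [h1.eventually_gt_atTop 0] with N hN
  field_simp
  ring

/-- The factors of the two products differ by a telescoping quotient: up to the constants displayed,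
the partial products differ by (β + n + 1 + N) / (n + 1 + N), which tends to 1. -/
theorem hrNorm_succ (n : ℕ) {α β : ℝ} (h : -1 < α + β) :
    (n + 1) * hrNorm n (α + 1) β = (β + n + 1) * hrNorm (n + 1) α β := by
  have hA := tendsto_prod_hrNorm n (α := α + 1) (β := β) (by linarith)
  have hB := tendsto_prod_hrNorm (n + 1) h
  have hn : ∀ k : ℕ, (n : ℝ) + 1 + k ≠ 0 := fun k => by positivity
  have hlim := (((tendsto_add_natCast_div (β + n + 1) (n + 1)).mul hA).const_mul ((n : ℝ) + 1))
  have hlim' := hB.const_mul (β + n + 1)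
  rw [one_mul] at hlim
  refine tendsto_nhds_unique hlim (hlim'.congr fun N => ?_)
  induction N with
  | zero =>
    have := hn 0
    simp only [Nat.cast_zero, add_zero] at this
    simp only [Nat.cast_zero, Finset.range_zero, Finset.prod_empty]
    field_simp
    ring
  | succ N ih =>
    rw [Finset.prod_range_succ, Finset.prod_range_succ, ← mul_assoc, ih]
    have h1 := hn N
    have h1' := hn (N + 1)
    have h5 : ∀ x y Z b b' m m' : ℝ, m ≠ 0 → m' ≠ 0 →
        (n + 1) * ((b / m) * Z) * ((x * b') / (m' * y)) =
        (n + 1) * (b' / m' * (Z * ((x * b) / (m * y)))) := by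
      intro x y Z b b' m m' hm hm'
      simp only [div_eq_mul_inv, mul_inv]
      ring
    have e1 : α + ((n + 1 : ℕ) : ℝ) + 1 + N = α + 1 + n + 1 + N := by push_cast; ring
    have e2 : β + ((n + 1 : ℕ) : ℝ) + 1 + N = β + n + 1 + (N + 1 : ℕ) := by push_cast; ring
    have e3 : ((n + 1 : ℕ) : ℝ) + 1 + N = n + 1 + (N + 1 : ℕ) := by push_cast; ring
    have e4 : α + β + ((n + 1 : ℕ) : ℝ) + 1 + N = α + 1 + β + n + 1 + N := by push_cast; ring
    rw [e1, e2, e3, e4]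
    exact h5 _ _ _ _ _ _ _ h1 h1'

/-- The mean value of the weight over the unit circle. -/
def hrMean (α β : ℝ) : ℂ := Real.circleAverage (hrWeight α β) 0 1

theorem hasCircleMean_hrWeight {α β : ℝ} (h : -1 < α + β) :
    HasCircleMean (hrWeight α β) (hrMean α β) :=
  ⟨by simpa using circleIntegrable_hrWeight_mul h (g := fun _ => 1) continuousOn_const, rfl⟩

/-- Applying z d/dz to w(z; α+1, β) gives (α+1) w(z; α+1, β) - (α+β+1) w(z; α, β), and an exact
derivative has mean zero. -/
theorem hrMean_add_one_left {α β : ℝ} (h : -1 < α + β) :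
    (α + 1) * hrMean (α + 1) β = (α + β + 1) * hrMean α β := by
  have hA := (hasCircleMean_hrWeight (α := α + 1) (β := β) (by linarith)).const_mul (α + 1)
  have hB := (hasCircleMean_hrWeight h).const_mul (-(α + β + 1))
  have h0 := hasCircleMean_zero_of_hasDerivAt (F := hrWeight (α + 1) β) (hA.add hB).1
    (fun z hz => (hasDerivAt_hrWeight (α + 1) β hz).congr_deriv ?_) ?_
  · linear_combination (hA.add hB).unique h0
  · rw [← one_sub_mul_hrWeight α β hz]
    have h0 := ne_zero_of_mem_puncturedCircle hz
    have h1 := one_sub_ne_zero_of_mem_puncturedCircle hz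
    push_cast
    field_simp
    ring
  · simpa using tendsto_hrWeight_mul (α := α + 1) (β := β) (by linarith) (g := fun _ => 1)
      continuousOn_const

theorem hrMean_add_one_right {α β : ℝ} (h : -1 < α + β) :
    (β + 1) * hrMean α (β + 1) = (α + β + 1) * hrMean α β := by
  have hA := (hasCircleMean_hrWeight (α := α) (β := β + 1) (by linarith)).const_mul (-(β + 1))
  have hB := (hasCircleMean_hrWeight h).const_mul (α + β + 1)
  have h0 := hasCircleMean_zero_of_hasDerivAt (F := hrWeight α (β + 1)) (hA.add hB).1
    (fun z hz => (hasDerivAt_hrWeight α (β + 1) hz).congr_deriv ?_) ?_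
  · linear_combination (-1 : ℂ) * (hA.add hB).unique h0
  · rw [hrWeight_add_one_right α β hz]
    have h0 := ne_zero_of_mem_puncturedCircle hz
    have h1 := one_sub_ne_zero_of_mem_puncturedCircle hz
    push_cast
    field_simp
    ring
  · simpa using tendsto_hrWeight_mul (α := α) (β := β + 1) (by linarith) (g := fun _ => 1)
      continuousOn_const

/-- With β = 0 the weight is (1-z)^s, holomorphic in the disc and, for s > 0, continuous up to its
boundary. Its mean is therefore its value at 0. -/
theorem hrMean_zero_right_of_pos {s : ℝ} (hs : 0 < s) : hrMean s 0 = 1 := by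
  have hw : hrWeight s 0 = fun z => (1 - z) ^ (s : ℂ) := by
    funext z; simp [hrWeight]
  have hd : DiffContOnCl ℂ (hrWeight s 0) (Metric.ball 0 |1|) := by
    rw [hw, abs_one]
    refine ⟨fun z hz => ?_, ?_⟩
    · have hre : 1 - z ∈ Complex.slitPlane := by
        left
        have h1 := Complex.re_le_norm z
        have h2 : ‖z‖ < 1 := by simpa using hz
        simp only [Complex.sub_re, Complex.one_re]
        linarith
      exact (((differentiableAt_const 1).sub differentiableAt_id).cpow_const
        hre).differentiableWithinAt
    · rw [closure_ball 0 one_ne_zero]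
      intro z hz
      have h2 : ‖z‖ ≤ 1 := by simpa using hz
      by_cases hz1 : z = 1
      · subst hz1
        have hc : ContinuousAt (fun x : ℂ => x ^ (s : ℂ)) (1 - 1) := by
          rw [sub_self]
          exact Complex.continuousAt_cpow_const_of_re_pos (by simp) (by simpa using hs)
        exact (ContinuousAt.comp (f := fun z : ℂ => 1 - z) hc
          (by fun_prop)).continuousWithinAt
      · have hre : 1 - z ∈ Complex.slitPlane := by
          rcases h2.eq_or_lt with h2 | h2
          · exact one_sub_mem_slitPlane ⟨h2, hz1⟩
          · left
            have h1 := Complex.re_le_norm z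
            simp only [Complex.sub_re, Complex.one_re]
            linarith
        exact ((continuousAt_const.sub continuousAt_id).cpow continuousAt_const
          hre).continuousWithinAt
  rw [hrMean, hd.circleAverage, hw]
  simp

theorem hrMean_zero_right {s : ℝ} (hs : -1 < s) : hrMean s 0 = 1 := by
  have h := hrMean_add_one_left (α := s) (β := 0) (by linarith)
  rw [hrMean_zero_right_of_pos (by linarith)] at h
  have h1 : (s : ℂ) + 1 ≠ 0 := by
    have : s + 1 ≠ 0 := by linarith
    exact_mod_cast this
  rw [Complex.ofReal_zero, add_zero] at h
  exact (mul_left_cancel₀ h1 h).symm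

theorem hrWeight_add_natCast (N : ℕ) (α β : ℝ) {θ : ℝ} (hθ : θ ∈ Set.Ioo 0 (2 * Real.pi)) :
    hrWeight (α + N) (β + N) (circleMap 0 1 θ) =
      (2 - 2 * Real.cos θ) ^ N • hrWeight α β (circleMap 0 1 θ) := by
  have hz := circleMap_mem_puncturedCircle hθ
  have h0 := ne_zero_of_mem_puncturedCircle hz
  have hc : ((2 - 2 * Real.cos θ : ℝ) : ℂ) =
      (1 - circleMap 0 1 θ) * (1 - (circleMap 0 1 θ)⁻¹) := by
    have : circleMap 0 1 θ = Complex.exp (θ * Complex.I) := by simp [circleMap]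
    rw [this, ← Complex.exp_neg]
    push_cast
    rw [Complex.two_cos]
    have h2 : Complex.exp (θ * Complex.I) * Complex.exp (-(θ * Complex.I)) = 1 := by
      rw [← Complex.exp_add, add_neg_cancel, Complex.exp_zero]
    rw [neg_mul]
    linear_combination (-1 : ℂ) * h2
  induction N with
  | zero => simp
  | succ N ih =>
    rw [Nat.cast_succ, ← add_assoc, ← add_assoc, hrWeight_add_one_right _ _ hz,
      ← one_sub_mul_hrWeight _ _ hz, ih, pow_succ, Complex.real_smul, Complex.real_smul,
      Complex.ofReal_mul, hc]
    ring

/-- Laplace's method: raising both parameters by N multiplies w by |1-z|^(2N) = (2 - 2 cos θ)^N,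
which concentrates at θ = π, where w(-1) = 2^(α+β). Normalizer and limit depend only on α + β. -/
theorem tendsto_hrMean_add_natCast {α β : ℝ} (h : -1 < α + β) :
    Tendsto (fun N : ℕ => (∫ θ in Set.Icc 0 (2 * Real.pi), (2 - 2 * Real.cos θ) ^ N)⁻¹ •
      ((2 * Real.pi) • hrMean (α + N) (β + N))) atTop (𝓝 ((2 : ℂ) ^ ((α : ℂ) + β))) := by
  have hpi := Real.pi_pos
  have hπ : Real.pi ∈ Set.Ioo 0 (2 * Real.pi) := ⟨hpi, by linarith⟩
  have key := tendsto_setIntegral_pow_smul_of_unique_maximum_of_isCompact_of_integrableOn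
    (μ := MeasureTheory.volume) (x₀ := Real.pi) (s := Set.Icc 0 (2 * Real.pi))
    (c := fun θ => 2 - 2 * Real.cos θ) (g := fun θ => hrWeight α β (circleMap 0 1 θ))
    isCompact_Icc (by fun_prop) ?_ ?_ ?_ ?_ ?_ ?_
  · have hval : hrWeight α β (circleMap 0 1 Real.pi) = (2 : ℂ) ^ ((α : ℂ) + β) := by
      have : circleMap 0 1 Real.pi = -1 := by simp [circleMap]
      rw [this, hrWeight, neg_neg, Complex.one_cpow, one_mul]
      norm_num
    rw [hval] at key
    refine key.congr fun N => ?_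
    congr 1
    rw [hrMean, Real.circleAverage_def, smul_inv_smul₀ (by positivity),
      intervalIntegral.integral_of_le (by positivity),
      MeasureTheory.integral_Icc_eq_integral_Ioc, MeasureTheory.integral_Ioc_eq_integral_Ioo,
      MeasureTheory.integral_Ioc_eq_integral_Ioo]
    exact MeasureTheory.setIntegral_congr_fun measurableSet_Ioo
      fun θ hθ => (hrWeight_add_natCast N α β hθ).symm
  · intro y hy hne
    rw [Real.cos_pi]
    by_contra! hle
    have hcos : Real.cos (y - Real.pi) = 1 := by
      rw [Real.cos_sub_pi]
      linarith [Real.neg_one_le_cos y]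
    rw [Real.cos_eq_one_iff_of_lt_of_lt (by linarith [hy.1]) (by linarith [hy.2])] at hcos
    exact hne (by linarith)
  · intro y _
    linarith [Real.cos_le_one y]
  · norm_num
  · rw [interior_Icc]
    exact subset_closure hπ
  · rw [integrableOn_Icc_iff_integrableOn_Ioc, ← intervalIntegrable_iff_integrableOn_Ioc_of_le
      (by positivity)]
    exact (hasCircleMean_hrWeight h).1
  · have hz := circleMap_mem_puncturedCircle hπ
    exact (ContinuousAt.comp (f := circleMap 0 1) (hasDerivAt_hrWeight α β hz).continuousAt
      (continuous_circleMap 0 1).continuousAt).continuousWithinAt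

theorem hrMean_add_one_add_one {α β : ℝ} (h : -1 < α + β) :
    (α + 1) * (β + 1) * hrMean (α + 1) (β + 1) = (α + β + 1) * (α + β + 2) * hrMean α β := by
  have h1 := hrMean_add_one_left h
  have h2 := hrMean_add_one_right (α := α + 1) (β := β) (by linarith)
  push_cast at h2
  linear_combination (α + 1 : ℂ) * h2 + (α + β + 2 : ℂ) * h1

/-- The parameter pairs (α, β) and (α+β, 0) have the same sum. Hence, when both parameters rise by
N, the right-hand factors of the two recurrences agree and the two means are asymptotically equal;
the left-hand factors build the product h_0. -/
theorem hrMean_eq_hrNorm {α β : ℝ} (h : -1 < α + β) : hrMean α β = hrNorm 0 α β := by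
  have hs0 : 0 < α + β + 1 := by linarith
  have hrec : ∀ (a b : ℝ), -1 < a + b → ∀ N : ℕ, ((a + N + 1 : ℝ) : ℂ) * ((b + N + 1 : ℝ) : ℂ) *
      hrMean (a + (N + 1 : ℕ)) (b + (N + 1 : ℕ)) =
      ((a + b + 2 * N + 1 : ℝ) : ℂ) * ((a + b + 2 * N + 2 : ℝ) : ℂ) * hrMean (a + N) (b + N) := by
    intro a b hab N
    have := hrMean_add_one_add_one (α := a + N) (β := b + N)
      (by linarith [(Nat.cast_nonneg N : (0 : ℝ) ≤ N)])
    rw [show a + ((N + 1 : ℕ) : ℝ) = a + N + 1 by push_cast; ring,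
      show b + ((N + 1 : ℕ) : ℝ) = b + N + 1 by push_cast; ring]
    push_cast at this ⊢
    linear_combination this
  have hD := hrec α β h
  have hE := hrec (α + β) 0 (by linarith)
  have hne : ∀ x : ℝ, 0 < x → (x : ℂ) ≠ 0 := fun x hx => by exact_mod_cast hx.ne'
  have hE0 : ∀ N : ℕ, hrMean (α + β + N) (0 + N) ≠ 0 := by
    intro N
    induction N with
    | zero => simp [hrMean_zero_right h]
    | succ N ih =>
      refine right_ne_zero_of_mul (a := ((α + β + N + 1 : ℝ) : ℂ) * ((0 + N + 1 : ℝ) : ℂ)) ?_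
      rw [hE N]
      refine mul_ne_zero (mul_ne_zero (hne _ ?_) (hne _ ?_)) ih
      · have : 0 < (α + β + 1) + 2 * N := by positivity
        linarith
      · have : 0 < (α + β + 1) + 2 * N + 1 := by positivity
        linarith
  have hratio : Tendsto (fun N : ℕ => hrMean (α + N) (β + N) / hrMean (α + β + N) (0 + N))
      atTop (𝓝 1) := by
    have h1 := tendsto_hrMean_add_natCast h
    have h2 := tendsto_hrMean_add_natCast (α := α + β) (β := 0) (by linarith)
    push_cast at h2
    rw [add_zero] at h2
    have h2ne : (2 : ℂ) ^ ((α : ℂ) + β) ≠ 0 := by simp [Complex.cpow_eq_zero_iff]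
    have h3 := h1.div h2 h2ne
    rw [div_self h2ne] at h3
    refine h3.congr' ?_
    filter_upwards [h2.eventually_ne h2ne] with N hN
    simp only [Complex.real_smul, Pi.div_apply] at hN ⊢
    rw [mul_div_mul_left _ _ (left_ne_zero_of_mul hN),
      mul_div_mul_left _ _ (left_ne_zero_of_mul (right_ne_zero_of_mul hN))]
  have hprod := (Complex.continuous_ofReal.tendsto _).comp (tendsto_prod_hrNorm 0 h)
  have hlim := hprod.mul hratio
  rw [mul_one] at hlim
  -- For every N, the mean is the N-th partial product times the ratio of the shifted means. In this
  -- direction one never divides by α + N + 1 or β + N + 1, which may vanish.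
  refine tendsto_nhds_unique (tendsto_const_nhds.congr fun N => ?_) hlim
  simp only [Function.comp_apply]
  induction N with
  | zero => simp [hrMean_zero_right h]
  | succ N ih =>
    rw [ih, Finset.prod_range_succ, Complex.ofReal_mul, mul_assoc]
    congr 1
    have e1 := hD N
    have e2 := hE N
    have k5 : ((α + β + 2 * N + 1 : ℝ) : ℂ) ≠ 0 := hne _ (by
      have : 0 < (α + β + 1) + 2 * N := by positivity
      linarith)
    have k6 : ((α + β + 2 * N + 2 : ℝ) : ℂ) ≠ 0 := hne _ (by
      have : 0 < (α + β + 1) + 2 * N + 1 := by positivity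
      linarith)
    rw [show ((α + (0 : ℕ) + 1 + N) * (β + (0 : ℕ) + 1 + N)) /
        (((0 : ℕ) + 1 + N) * (α + β + (0 : ℕ) + 1 + N)) =
      ((α + N + 1) * (β + N + 1)) / ((0 + N + 1) * (α + β + N + 1)) by push_cast; ring_nf]
    rw [add_zero] at e2
    have e1' := eq_div_of_mul_eq (mul_ne_zero k5 k6) ((mul_comm _ _).trans e1.symm)
    have e2' := eq_div_of_mul_eq (mul_ne_zero k5 k6) ((mul_comm _ _).trans e2.symm)
    rw [e1', e2', Complex.ofReal_div, Complex.ofReal_mul, Complex.ofReal_mul,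
      div_div_div_cancel_right₀ (mul_ne_zero k5 k6), mul_div_mul_comm,
      mul_comm ((0 + N + 1 : ℝ) : ℂ)]

end NormalizationConstant

/-! ### Integration by parts and the ordinary biorthogonality. -/

section Darboux

open Filter Topology Polynomial

/-- The function `(n z - (n + β)) P_n(z) + z (1 - z) P_n'(z)`; divided by `z ^ n` it is, up to a
constant factor, the biorthogonal partner of `P_n`. -/
def hrDual (n : ℕ) (α β : ℝ) (z : ℂ) : ℂ :=
  (n * z - (n + β)) * (hrPolynomial n α β).eval z +
    z * (1 - z) * (derivative (hrPolynomial n α β)).eval z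

theorem continuousOn_inv_pow_circle (n : ℕ) :
    ContinuousOn (fun z : ℂ => (z ^ n)⁻¹) {z | ‖z‖ = 1} := by
  refine (continuous_pow n).continuousOn.inv₀ fun z hz => pow_ne_zero n ?_
  exact norm_ne_zero_iff.mp (by rw [hz]; exact one_ne_zero)

/-- Up to a constant, z · z^(-n) (1-z) w is z^(1-n-β) (1-z)^(1+α+β), the Sturm–Liouville factor of
the equation with eigenvalue n. This is why that equation simplifies the derivatives below. -/
theorem hasDerivAt_inv_pow_mul_hrWeight_mul (n : ℕ) (α β : ℝ) {G : ℂ → ℂ} {G' z : ℂ}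
    (hz : z ∈ puncturedCircle) (hG : HasDerivAt G G' z) :
    HasDerivAt (fun z => (z ^ n)⁻¹ * ((1 - z) * hrWeight α β z) * G z)
      ((z ^ n)⁻¹ * hrWeight α β z *
        ((-(n + β) * (1 - z) - z * (1 + α + β)) * G z + z * (1 - z) * G') / z) z := by
  have h0 := ne_zero_of_mem_puncturedCircle hz
  have h1 := one_sub_ne_zero_of_mem_puncturedCircle hz
  have hpow := ((hasDerivAt_pow n z).inv (pow_ne_zero n h0))
  have hw := ((hasDerivAt_id z).const_sub 1).mul (hasDerivAt_hrWeight α β hz)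
  refine HasDerivAt.congr_deriv
    (f := fun z => (z ^ n)⁻¹ * ((1 - z) * hrWeight α β z) * G z) ((hpow.mul hw).mul hG) ?_
  rcases n with _ | n
  · simp only [Pi.mul_apply, Pi.inv_apply, id, pow_zero, Nat.cast_zero]
    field_simp
    ring
  · simp only [Pi.mul_apply, Pi.inv_apply, id, Nat.add_sub_cancel, pow_succ]
    have := pow_ne_zero n h0
    push_cast
    field_simp
    ring

theorem continuous_hrDual (n : ℕ) (α β : ℝ) : Continuous (hrDual n α β) := by
  unfold hrDual
  have h1 := (hrPolynomial n α β).continuous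
  have h2 := (derivative (hrPolynomial n α β)).continuous
  fun_prop

theorem circleIntegrable_hrDual {α β : ℝ} (h : -1 < α + β) (n : ℕ) (p : ℂ[X]) :
    CircleIntegrable (fun z => (z ^ n)⁻¹ * hrWeight α β z * (p.eval z * hrDual n α β z)) 0 1 := by
  have := circleIntegrable_hrWeight_mul h (g := fun z => (z ^ n)⁻¹ * (p.eval z * hrDual n α β z))
    ((continuousOn_inv_pow_circle n).mul
      (p.continuous.mul (continuous_hrDual n α β)).continuousOn)
  refine this.congr fun z _ => ?_
  ring

/-- The Darboux transformation by a seed with logarithmic derivative `r` and eigenvalue `θ`,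
reduced to the untransformed pairing by an integration by parts. -/
theorem hasCircleMean_darboux {α β s θ : ℝ} (h : -1 < α + β) (hs : s ≠ 0 → 0 < α + β)
    (n : ℕ) (p : ℂ[X]) {r r' r₀ : ℂ → ℂ} (hr : ∀ z ∈ puncturedCircle, HasDerivAt r (r' z) z)
    (hr₀ : ContinuousOn r₀ {z | ‖z‖ = 1})
    (hrr₀ : ∀ z ∈ puncturedCircle, r z = r₀ z + s / (1 - z))
    (hric : ∀ z ∈ puncturedCircle, z * (1 - z) * (r' z + r z ^ 2) +
      (1 - β - θ - (α + 2 - θ) * z) * r z + θ * (α + 1) = 0) {c : ℂ}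
    (hc : HasCircleMean (fun z => (z ^ n)⁻¹ * hrWeight α β z * (p.eval z * hrDual n α β z)) c) :
    HasCircleMean (fun z => (z ^ n)⁻¹ * z * (1 - z) * hrWeight α β z *
      ((derivative p).eval z - r z * p.eval z) *
      (z * (derivative (hrPolynomial n α β)).eval z - z * r z * (hrPolynomial n α β).eval z -
        (n - θ) * (hrPolynomial n α β).eval z)) ((n - θ) * c) := by
  set q := hrPolynomial n α β with hq
  set B : ℂ → ℂ := fun z => z * (derivative q).eval z - z * r z * q.eval z -
    (n - θ) * q.eval z with hB
  set A₀ : ℂ → ℂ := fun z => (derivative p).eval z - r₀ z * p.eval z with hA₀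
  set B₀ : ℂ → ℂ := fun z => z * (derivative q).eval z - z * r₀ z * q.eval z -
    (n - θ) * q.eval z with hB₀
  have hv := continuousOn_inv_pow_circle n
  have hpc : ContinuousOn (fun z => p.eval z) {z | ‖z‖ = 1} := p.continuous.continuousOn
  have hpc' : ContinuousOn (fun z => (derivative p).eval z) {z | ‖z‖ = 1} :=
    (derivative p).continuous.continuousOn
  have hqc : ContinuousOn (fun z => q.eval z) {z | ‖z‖ = 1} := q.continuous.continuousOn
  have hqc' : ContinuousOn (fun z => (derivative q).eval z) {z | ‖z‖ = 1} :=
    (derivative q).continuous.continuousOn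
  have hA₀c : ContinuousOn A₀ {z | ‖z‖ = 1} := by fun_prop
  have hB₀c : ContinuousOn B₀ {z | ‖z‖ = 1} := by fun_prop
  have hone : ∀ z ∈ puncturedCircle,
      (1 - z) * (r z) = (1 - z) * r₀ z + s := by
    intro z hz
    have h1 := one_sub_ne_zero_of_mem_puncturedCircle hz
    rw [hrr₀ z hz]
    field_simp
  -- the transformed integrand is integrable
  have hint : CircleIntegrable (fun z => (z ^ n)⁻¹ * z * (1 - z) * hrWeight α β z *
      ((derivative p).eval z - r z * p.eval z) * B z) 0 1 := by
    by_cases hs0 : s = 0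
    · refine (HasCircleMean.congr (CircleIntegrable.hasCircleMean
        (circleIntegrable_hrWeight_mul h (g := fun z => (z ^ n)⁻¹ * z * (1 - z) * A₀ z * B₀ z)
        (by fun_prop))) fun z hz => ?_).1
      have : r z = r₀ z := by rw [hrr₀ z hz, hs0]; simp
      simp only [hA₀, hB₀, hB, this]
      ring
    -- A and B each have a simple pole at 1. One of the two is cancelled by the factor 1 - z; the
    -- other is absorbed by passing to the weight with α - 1, integrable since α + β > 0.
    · refine (HasCircleMean.congr (CircleIntegrable.hasCircleMean
        (circleIntegrable_hrWeight_mul (α := α - 1) (β := β) (by linarith [hs hs0])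
        (g := fun z => (z ^ n)⁻¹ * z * ((1 - z) * A₀ z - s * p.eval z) *
          ((1 - z) * B₀ z - s * z * q.eval z))
        (by fun_prop))) fun z hz => ?_).1
      have hw := one_sub_mul_hrWeight (α - 1) β hz
      rw [sub_add_cancel] at hw
      have e1 : (1 - z) * A₀ z - s * p.eval z =
          (1 - z) * ((derivative p).eval z - r z * p.eval z) := by
        linear_combination p.eval z * hone z hz
      have e2 : (1 - z) * B₀ z - s * z * q.eval z = (1 - z) * B z := by
        linear_combination z * q.eval z * hone z hz
      rw [e1, e2, ← hw]
      ring
  -- the boundary terms vanish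
  have hlim : Tendsto (fun z => (z ^ n)⁻¹ * ((1 - z) * hrWeight α β z) * (p.eval z * B z))
      (𝓝[puncturedCircle] 1) (𝓝 0) := by
    by_cases hs0 : s = 0
    · refine (tendsto_hrWeight_mul (α := α + 1) (β := β) (by linarith)
        (g := fun z => (z ^ n)⁻¹ * (p.eval z * B₀ z)) (by fun_prop)).congr' ?_
      filter_upwards [self_mem_nhdsWithin] with z hz
      have : r z = r₀ z := by rw [hrr₀ z hz, hs0]; simp
      simp only [hB₀, hB, this, ← one_sub_mul_hrWeight α β hz]
      ring
    · refine (tendsto_hrWeight_mul (hs hs0)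
        (g := fun z => (z ^ n)⁻¹ * (p.eval z * ((1 - z) * B₀ z - s * z * q.eval z)))
        (by fun_prop)).congr' ?_
      filter_upwards [self_mem_nhdsWithin] with z hz
      have e2 : (1 - z) * B₀ z - s * z * q.eval z = (1 - z) * B z := by
        linear_combination z * q.eval z * hone z hz
      rw [e2]
      ring
  have hc' := hc.const_mul (-(n - θ))
  have hsum := (CircleIntegrable.hasCircleMean hint).add hc'
  have hzero := hasCircleMean_zero_of_hasDerivAt hsum.1 (fun z hz => ?_) hlim
  · refine ⟨hint, ?_⟩
    linear_combination hsum.unique hzero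
  · have h0 := ne_zero_of_mem_puncturedCircle hz
    have h1 := one_sub_ne_zero_of_mem_puncturedCircle hz
    have hq' := q.hasDerivAt z
    have hBd := ((((hasDerivAt_id z).mul ((derivative q).hasDerivAt z)).sub
      (((hasDerivAt_id z).mul (hr z hz)).mul hq')).sub (hq'.const_mul ((n : ℂ) - θ)))
    refine (hasDerivAt_inv_pow_mul_hrWeight_mul n α β hz
      ((p.hasDerivAt z).mul (HasDerivAt.congr_deriv (f := B) hBd rfl))).congr_deriv ?_
    have hode := hrPolynomial_ode n α β z
    rw [← hq] at hode
    rw [div_left_inj' h0]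
    simp only [hB, hrDual, ← hq, id, Pi.mul_apply]
    -- Only the equation of P_n and the Riccati equation enter; p is arbitrary.
    linear_combination (z ^ n)⁻¹ * hrWeight α β z * p.eval z * z * hode -
      (z ^ n)⁻¹ * hrWeight α β z * p.eval z * z * q.eval z * hric z hz

/-- This is the Darboux identity with P_m itself as seed, for which P_m' - r P_m = 0. The polynomial
V is P_m B with r = P_m'/P_m multiplied out, so zeros of P_m on the circle do no harm. -/
theorem hasCircleMean_hrDual_of_ne {α β : ℝ} (h : -1 < α + β) {m n : ℕ} (hmn : m ≠ n) :
    HasCircleMean (fun z => (z ^ n)⁻¹ * hrWeight α β z *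
      ((hrPolynomial m α β).eval z * hrDual n α β z)) 0 := by
  set p := hrPolynomial m α β with hp
  set q := hrPolynomial n α β with hq
  set V : ℂ[X] := p * (X * derivative q - C ((n : ℂ) - m) * q) - X * derivative p * q with hV
  have hne : (m : ℂ) - n ≠ 0 := sub_ne_zero.mpr (by exact_mod_cast hmn)
  have hI := ((circleIntegrable_hrDual h n p).hasCircleMean).const_mul ((m : ℂ) - n)
  have hzero := hasCircleMean_zero_of_hasDerivAt
    (F := fun z => (z ^ n)⁻¹ * ((1 - z) * hrWeight α β z) * V.eval z) hI.1 (fun z hz => ?_) ?_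
  · have := hzero.const_mul ((m : ℂ) - n)⁻¹
    rw [mul_zero] at this
    refine this.congr fun z _ => ?_
    rw [inv_mul_cancel_left₀ hne]
  · have h0 := ne_zero_of_mem_puncturedCircle hz
    refine (hasDerivAt_inv_pow_mul_hrWeight_mul n α β hz (V.hasDerivAt z)).congr_deriv ?_
    have hode := hrPolynomial_ode n α β z
    have hode' := hrPolynomial_ode m α β z
    rw [← hq] at hode
    rw [← hp] at hode'
    rw [div_left_inj' h0]
    simp only [hV, hrDual, ← hq, derivative_sub, derivative_mul, derivative_X, derivative_C,
      eval_sub, eval_mul, eval_add, eval_X, eval_C, eval_one, eval_zero]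
    linear_combination (z ^ n)⁻¹ * hrWeight α β z * z * p.eval z * hode -
      (z ^ n)⁻¹ * hrWeight α β z * z * q.eval z * hode'
  · refine (tendsto_hrWeight_mul (α := α + 1) (β := β) (by linarith)
      (g := fun z => (z ^ n)⁻¹ * V.eval z)
      ((continuousOn_inv_pow_circle n).mul V.continuous.continuousOn)).congr' ?_
    filter_upwards [self_mem_nhdsWithin] with z hz
    rw [← one_sub_mul_hrWeight α β hz]
    ring

theorem hrPolynomial_zero (α β : ℝ) : hrPolynomial 0 α β = 1 := by
  simp [hrPolynomial]

/-- With the trivial seed r = 0, θ = 0, the transform of P_(n+1) is its derivative (n+1) P_n(z; α+1,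
β). By the hypergeometric equation z P_(n+1)' - (n+1) P_(n+1) is (n+1)/(α+1) times `hrDual n (α + 1)
β`, and the factor 1 - z raises α in the weight. The induction therefore varies α. -/
theorem hasCircleMean_hrDual_self (n : ℕ) {α β : ℝ} (h : -1 < α + β)
    (hα : ∀ k : ℕ, α + 1 + k ≠ 0) :
    HasCircleMean (fun z => (z ^ n)⁻¹ * hrWeight α β z *
      ((hrPolynomial n α β).eval z * hrDual n α β z))
      ((-(n + β) * hrNorm n α β *
        ((ascPochhammer ℝ n).eval β / (ascPochhammer ℝ n).eval (α + 1)) : ℝ) : ℂ) := by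
  induction n generalizing α with
  | zero =>
    have hmean := (hasCircleMean_hrWeight h).const_mul (-β)
    rw [hrMean_eq_hrNorm h] at hmean
    have : HasCircleMean (fun z => (z ^ 0)⁻¹ * hrWeight α β z *
      ((hrPolynomial 0 α β).eval z * hrDual 0 α β z)) (-β * (hrNorm 0 α β : ℝ)) := by
      refine hmean.congr fun z _ => ?_
      simp [hrDual, hrPolynomial_zero]
      ring
    simpa using this
  | succ n ih =>
    have hα0 : α + 1 ≠ 0 := by simpa using hα 0
    have hα0' : (α : ℂ) + 1 ≠ 0 := by exact_mod_cast hα0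
    have hn0 : (n : ℂ) + 1 ≠ 0 := by exact_mod_cast n.succ_ne_zero
    have ih := ih (α := α + 1) (by linarith) fun k => by
      have := hα (k + 1); push_cast at this; intro h; exact this (by linarith)
    have hI := (circleIntegrable_hrDual h (n + 1) (hrPolynomial (n + 1) α β)).hasCircleMean
    have hD := hasCircleMean_darboux (s := 0) (θ := 0) h (fun h => absurd rfl h) (n + 1)
      (hrPolynomial (n + 1) α β) (r := fun _ => 0) (r' := fun _ => 0) (r₀ := fun _ => 0)
      (fun z _ => hasDerivAt_const z 0) continuousOn_const (by simp) (by simp) hI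
    have hder := derivative_hrPolynomial (fun k (_ : k < n + 1) => hα k) β
    rw [Nat.add_sub_cancel, ← C_eq_natCast] at hder
    have hE := (ih.const_mul (((n : ℂ) + 1) ^ 2 / (α + 1))).congr
      (g := fun z => (z ^ (n + 1))⁻¹ * z * (1 - z) * hrWeight α β z *
        ((derivative (hrPolynomial (n + 1) α β)).eval z -
          (0 : ℂ) * (hrPolynomial (n + 1) α β).eval z) *
        (z * (derivative (hrPolynomial (n + 1) α β)).eval z -
          z * (0 : ℂ) * (hrPolynomial (n + 1) α β).eval z -
          (((n + 1 : ℕ) : ℂ) - (0 : ℝ)) * (hrPolynomial (n + 1) α β).eval z)) fun z hz => by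
      have h0 := ne_zero_of_mem_puncturedCircle hz
      have hode := hrPolynomial_ode (n + 1) α β z
      rw [hder] at hode ⊢
      rw [derivative_C_mul] at hode
      simp only [eval_mul, eval_C] at hode ⊢
      rw [← one_sub_mul_hrWeight α β hz]
      unfold hrDual
      push_cast at hode ⊢
      set p := eval z (hrPolynomial (n + 1) α β)
      set q := eval z (hrPolynomial n (α + 1) β)
      set q' := eval z (derivative (hrPolynomial n (α + 1) β))
      rw [div_mul_eq_mul_div, div_eq_iff hα0', pow_succ z n, mul_inv]
      have e : (z ^ n)⁻¹ * z⁻¹ * z = (z ^ n)⁻¹ := by rw [mul_assoc, inv_mul_cancel₀ h0, mul_one]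
      rw [e]
      linear_combination (z ^ n)⁻¹ * (1 - z) * hrWeight α β z * (n + 1) * q * hode
    have huniq := hD.unique hE
    rw [show Real.circleAverage _ 0 1 = _ from mul_left_cancel₀ (a := ((n : ℂ) + 1)) hn0
      (b := _) (c := ((-((n + 1 : ℕ) + β) * hrNorm (n + 1) α β * ((ascPochhammer ℝ (n + 1)).eval β /
        (ascPochhammer ℝ (n + 1)).eval (α + 1)) : ℝ) : ℂ)) ?_] at hI
    · exact hI
    · have hnorm := hrNorm_succ n h
      have hnorm' : ((n : ℂ) + 1) * hrNorm n (α + 1) β = (β + n + 1) * hrNorm (n + 1) α β := by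
        exact_mod_cast hnorm
      push_cast at huniq
      rw [sub_zero] at huniq
      rw [huniq, ascPochhammer_succ_eval n, ascPochhammer_eval_succ_left n (α + 1)]
      push_cast
      simp only [div_eq_mul_inv, mul_inv]
      set T : ℂ := (((ascPochhammer ℝ n).eval β : ℝ) : ℂ)
      set U : ℂ := (((ascPochhammer ℝ n).eval (α + 1 + 1) : ℝ) : ℂ)⁻¹
      linear_combination (-1 : ℂ) * ((n : ℂ) + 1) * (n + β) * T * U * ((α : ℂ) + 1)⁻¹ * hnorm'

end Darboux

/-! ### Exceptional polynomials as Darboux transforms. -/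

section Exceptional

open Filter Topology Polynomial

/-- The parameters are tied by equations because those of a reflected seed, such as -(β - 1), match
the required form only after algebra. -/
theorem hrPolynomial_eval_inv' {n : ℕ} {α β a b : ℝ} (hα : ∀ k < n, α + 1 + k ≠ 0)
    (ha : a = β - 1) (hb : b = α + 1) {z : ℂ} (hz : z ≠ 0) :
    (hrPolynomial n a b).eval z⁻¹ =
      (((ascPochhammer ℝ n).eval (α + 1) / (ascPochhammer ℝ n).eval β : ℝ) : ℂ) * (z ^ n)⁻¹ *
        (hrPolynomial n α β).eval z := by
  subst ha hb
  exact hrPolynomial_eval_inv hα β hz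

theorem derivative_hrPolynomial_eval_inv {n : ℕ} {α β a b : ℝ} (hα : ∀ k < n, α + 1 + k ≠ 0)
    (ha : a = β - 1) (hb : b = α + 1) {z : ℂ} (hz : z ≠ 0) :
    (derivative (hrPolynomial n a b)).eval z⁻¹ =
      (((ascPochhammer ℝ n).eval (α + 1) / (ascPochhammer ℝ n).eval β : ℝ) : ℂ) * (z ^ n)⁻¹ *
        (z * (n * (hrPolynomial n α β).eval z -
          z * (derivative (hrPolynomial n α β)).eval z)) := by
  set κ : ℂ := (((ascPochhammer ℝ n).eval (α + 1) / (ascPochhammer ℝ n).eval β : ℝ) : ℂ)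
  have h1 := ((hrPolynomial n a b).hasDerivAt z⁻¹).comp z (hasDerivAt_inv hz)
  have h2 := (((hasDerivAt_pow n z).inv (pow_ne_zero n hz)).const_mul κ).mul
    ((hrPolynomial n α β).hasDerivAt z)
  have h3 := h1.unique (h2.congr_of_eventuallyEq (by
    filter_upwards [isOpen_ne.mem_nhds hz] with y hy
    exact hrPolynomial_eval_inv' hα ha hb hy))
  have hz2 : z ^ 2 ≠ 0 := pow_ne_zero 2 hz
  have hzn : z ^ n ≠ 0 := pow_ne_zero n hz
  have h4 : (derivative (hrPolynomial n a b)).eval z⁻¹ = -(z ^ 2) *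
      ((derivative (hrPolynomial n a b)).eval z⁻¹ * -(z ^ 2)⁻¹) := by field_simp
  rw [h4, h3]
  rcases n with _ | n
  · simp; ring
  · simp only [Pi.inv_apply, Nat.add_sub_cancel, pow_succ] at hzn ⊢
    field_simp
    push_cast
    ring

theorem natCast_mul_hrPoly {n : ℕ} {α β a : ℝ} (ha : a = α + 1) (hα : ∀ k < n, α + 1 + k ≠ 0)
    (hβ : ∀ k < n, β + k ≠ 0) (z : ℂ) :
    n * hrPoly (n - 1) a β z = (derivative (hrPolynomial n α β)).eval z := by
  subst ha
  rw [derivative_hrPolynomial hα, hrPoly_eq_eval fun k hk => hβ k (by omega), ← C_eq_natCast,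
    eval_mul, eval_C]

theorem natCast_mul_div_mul_hrPoly {n : ℕ} {α β b : ℝ} (hb : b = β + 1)
    (hβ : ∀ k < n, β + k ≠ 0) (z : ℂ) :
    β * n / (α + n) * hrPoly (n - 1) α b z =
      n * (hrPolynomial n α β).eval z - z * (derivative (hrPolynomial n α β)).eval z := by
  subst hb
  have h := congrArg (eval z) (natCast_mul_hrPolynomial_sub n α β)
  rw [← C_eq_natCast] at h
  simp only [eval_sub, eval_mul, eval_C, eval_X] at h
  rw [h, hrPoly_eq_eval fun k hk => ?_, mul_comm (β : ℂ)]
  have := hβ (k + 1) (by omega)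
  push_cast at this
  rwa [add_assoc, add_comm 1]

/-- The rational function `a / z + s / (1 - z)`, the logarithmic derivative of
`z ^ a * (1 - z) ^ (-s)`. -/
def powLogDeriv (a s : ℝ) (z : ℂ) : ℂ := a / z + s / (1 - z)

/-- Biorthogonality for a seed function of the form `z ^ a * (1 - z) ^ (-s) * D z`. -/
theorem hasCircleMean_seed {α β a s θ : ℝ} (h : -1 < α + β) (hα : ∀ k : ℕ, α + 1 + k ≠ 0)
    (hβ : ∀ k : ℕ, β + k ≠ 0) (hs : s ≠ 0 → 0 < α + β) (D : ℂ[X])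
    (hD : ∀ z : ℂ, ‖z‖ = 1 → D.eval z ≠ 0)
    (hode : ∀ z ∈ puncturedCircle, z * (1 - z) * ((derivative (derivative D)).eval z +
      2 * powLogDeriv a s z * (derivative D).eval z +
        (-a / z ^ 2 + s / (1 - z) ^ 2 + powLogDeriv a s z ^ 2) * D.eval z) +
      (1 - β - θ - (α + 2 - θ) * z) * ((derivative D).eval z + powLogDeriv a s z * D.eval z) +
      θ * (α + 1) * D.eval z = 0) (m n : ℕ) :
    HasCircleMean (fun z =>
      (((ascPochhammer ℝ n).eval (α + 1) / (ascPochhammer ℝ n).eval β : ℝ) : ℂ) *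
      ((z ^ n)⁻¹ * z * (1 - z) * hrWeight α β z *
        (D.eval z * (derivative (hrPolynomial m α β)).eval z -
          ((derivative D).eval z + powLogDeriv a s z * D.eval z) * (hrPolynomial m α β).eval z) *
        (z * D.eval z * (derivative (hrPolynomial n α β)).eval z -
          z * ((derivative D).eval z + powLogDeriv a s z * D.eval z) *
            (hrPolynomial n α β).eval z -
          (n - θ) * D.eval z * (hrPolynomial n α β).eval z) / D.eval z ^ 2))
      (if m = n then ((-(n + β) * (n - θ) * hrNorm n α β : ℝ) : ℂ) else 0) := by
  set κ := (ascPochhammer ℝ n).eval (α + 1) / (ascPochhammer ℝ n).eval β with hκ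
  have hA : (ascPochhammer ℝ n).eval (α + 1) ≠ 0 := ascPochhammer_eval_ne_zero fun k _ => hα k
  have hB : (ascPochhammer ℝ n).eval β ≠ 0 := ascPochhammer_eval_ne_zero fun k _ => hβ k
  have hbase : HasCircleMean (fun z => (z ^ n)⁻¹ * hrWeight α β z *
      ((hrPolynomial m α β).eval z * hrDual n α β z))
      (if m = n then ((-(n + β) * hrNorm n α β * κ⁻¹ : ℝ) : ℂ) else 0) := by
    split_ifs with hmn
    · subst hmn
      rw [hκ, inv_div]
      exact hasCircleMean_hrDual_self m h hα
    · exact hasCircleMean_hrDual_of_ne h hmn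
  have hDc : ContinuousOn (fun z => (derivative D).eval z / D.eval z) {z | ‖z‖ = 1} :=
    (derivative D).continuous.continuousOn.div D.continuous.continuousOn fun z hz => hD z hz
  have key := (hasCircleMean_darboux (θ := θ) h hs n (hrPolynomial m α β)
    (r := fun z => (derivative D).eval z / D.eval z + powLogDeriv a s z)
    (r' := fun z => ((derivative (derivative D)).eval z * D.eval z -
      (derivative D).eval z * (derivative D).eval z) / D.eval z ^ 2 +
      (-a / z ^ 2 + s / (1 - z) ^ 2))
    -- On the circle D and z do not vanish, so s / (1 - z) is the only singular part of r.
    (r₀ := fun z => (derivative D).eval z / D.eval z + a / z)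
    (fun z hz => ?_) ?_ ?_ ?_ hbase).const_mul (κ : ℂ)
  · have hval : (κ : ℂ) * (((n : ℂ) - θ) *
        (if m = n then ((-(n + β) * hrNorm n α β * κ⁻¹ : ℝ) : ℂ) else 0)) =
        if m = n then ((-(n + β) * (n - θ) * hrNorm n α β : ℝ) : ℂ) else 0 := by
      split_ifs
      · have hκ0 : (κ : ℂ) ≠ 0 := by exact_mod_cast div_ne_zero hA hB
        push_cast
        field_simp
      · simp
    rw [hval] at key
    refine key.congr fun z hz => ?_
    have := hD z hz.1
    congr 1
    field_simp
  · have h0 := ne_zero_of_mem_puncturedCircle hz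
    have h1 := one_sub_ne_zero_of_mem_puncturedCircle hz
    have h2 := ((derivative D).hasDerivAt z).div (D.hasDerivAt z) (hD z hz.1)
    have h3 := (hasDerivAt_inv h0).const_mul (a : ℂ)
    have h4 := (((hasDerivAt_id z).const_sub 1).inv h1).const_mul (s : ℂ)
    refine HasDerivAt.congr_deriv
      (f := fun z => (derivative D).eval z / D.eval z + powLogDeriv a s z) (h2.add (h3.add h4)) ?_
    simp only [id]
    ring
  · refine hDc.add (continuousOn_const.div continuousOn_id fun z hz => ?_)
    exact norm_ne_zero_iff.mp (by rw [show ‖z‖ = 1 from hz]; exact one_ne_zero)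
  · intro z _
    simp only [powLogDeriv]
    ring
  · intro z hz
    have hD0 := hD z hz.1
    have e := hode z hz
    set L := powLogDeriv a s z
    set M := -(a : ℂ) / z ^ 2 + s / (1 - z) ^ 2
    refine mul_left_cancel₀ hD0 ?_
    rw [mul_zero, ← e]
    field_simp
    ring

/-! ### The four seeds. -/

section Seeds

variable {l : ℕ} {α β : ℝ}

/-- This and its three analogues exhibit each exceptional polynomial, up to a constant, as D (P_n' -
r P_n) times the clearing factor 1, 1-z, z or z (z-1) of types one to four. -/
theorem xhrPoly_one_eq (l n : ℕ) (hα : ∀ k : ℕ, α + 1 + k ≠ 0) (hβ : ∀ k : ℕ, β + k ≠ 0) (z : ℂ) :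
    xhrPoly .one l n α β z =
      (hrPolynomial l α β).eval z * (derivative (hrPolynomial n α β)).eval z -
      (derivative (hrPolynomial l α β)).eval z * (hrPolynomial n α β).eval z := by
  rw [← natCast_mul_hrPoly rfl (fun k _ => hα k) (fun k _ => hβ k),
    ← natCast_mul_hrPoly rfl (fun k _ => hα k) (fun k _ => hβ k),
    ← hrPoly_eq_eval fun k _ => hβ k, ← hrPoly_eq_eval fun k _ => hβ k, xhrPoly]
  ring

theorem xhrPoly_two_eq (n : ℕ) (hα : ∀ k : ℕ, α + 1 + k ≠ 0) (hβ : ∀ k : ℕ, β + k ≠ 0)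
    (hα' : ∀ k < l, -α + k ≠ 0) (hβ' : ∀ k < l, -β + 1 + k ≠ 0) (z : ℂ) :
    xhrPoly .two l n α β z =
      (1 - z) * ((hrPolynomial l (-β) (-α)).eval z * (derivative (hrPolynomial n α β)).eval z -
        (derivative (hrPolynomial l (-β) (-α))).eval z * (hrPolynomial n α β).eval z) -
      (α + β) * (hrPolynomial l (-β) (-α)).eval z * (hrPolynomial n α β).eval z := by
  rw [← natCast_mul_hrPoly rfl (fun k _ => hα k) (fun k _ => hβ k),
    ← natCast_mul_hrPoly (a := 1 - β) (by ring) hβ' hα',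
    ← hrPoly_eq_eval fun k _ => hβ k, ← hrPoly_eq_eval hα', xhrPoly]
  ring

theorem xhrPoly_three_eq (l n : ℕ) (hα : ∀ k : ℕ, α + 1 + k ≠ 0) (hβ : ∀ k : ℕ, β + k ≠ 0)
    (z : ℂ) :
    xhrPoly .three l n α β z =
      (((ascPochhammer ℝ l).eval β / (ascPochhammer ℝ l).eval (α + 1) : ℝ) : ℂ) *
      (z * ((hrPolynomial l (β - 1) (α + 1)).eval z *
          (derivative (hrPolynomial n α β)).eval z -
        (derivative (hrPolynomial l (β - 1) (α + 1))).eval z * (hrPolynomial n α β).eval z) +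
      (l + 1 + α) * (hrPolynomial l (β - 1) (α + 1)).eval z * (hrPolynomial n α β).eval z) := by
  have e := natCast_mul_div_mul_hrPoly (n := l) (α := β - 1) (β := α + 1) (b := α + 2) (by ring)
    (fun k _ => hα k) z
  rw [xhrPoly, hrPoly_eq_eval (n := n) (β := β) fun k _ => hβ k,
    hrPoly_eq_eval (n := l) (β := α + 1) fun k _ => hα k]
  congr 1
  have e2 := natCast_mul_hrPoly (n := n) rfl (fun k _ => hα k) (fun k _ => hβ k) z
  rw [show (β : ℂ) + l - 1 = ((β - 1 : ℝ) : ℂ) + l by push_cast; ring,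
    show (α : ℂ) + 1 = ((α + 1 : ℝ) : ℂ) by push_cast; ring, e, ← e2]
  ring

/-- Uses -(1 - β - (1+α) z) = (z - 1)(1 - β) + (α+β) z to separate the contributions of the poles of
r at 0 and at 1. -/
theorem xhrPoly_four_eq (n : ℕ) (hα : ∀ k : ℕ, α + 1 + k ≠ 0) (hβ : ∀ k : ℕ, β + k ≠ 0)
    (hβ' : ∀ k < l, -β + 1 + k ≠ 0) (z : ℂ) :
    xhrPoly .four l n α β z =
      (((ascPochhammer ℝ l).eval (-α) / (ascPochhammer ℝ l).eval (-β + 1) : ℝ) : ℂ) *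
      ((z - 1) * (z * ((hrPolynomial l (-α - 1) (-β + 1)).eval z *
          (derivative (hrPolynomial n α β)).eval z -
        (derivative (hrPolynomial l (-α - 1) (-β + 1))).eval z * (hrPolynomial n α β).eval z) +
      (l + 1 - β) * (hrPolynomial l (-α - 1) (-β + 1)).eval z * (hrPolynomial n α β).eval z) +
      (α + β) * z * (hrPolynomial l (-α - 1) (-β + 1)).eval z * (hrPolynomial n α β).eval z) := by
  have e := natCast_mul_div_mul_hrPoly (n := l) (α := -α - 1) (β := -β + 1) (b := -β + 2)
    (by ring) hβ' z
  rw [xhrPoly, hrPoly_eq_eval (n := n) (β := β) fun k _ => hβ k,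
    hrPoly_eq_eval (n := l) (β := -β + 1) hβ']
  congr 1
  have e2 := natCast_mul_hrPoly (n := n) rfl (fun k _ => hα k) (fun k _ => hβ k) z
  rw [show -(α : ℂ) + l - 1 = ((-α - 1 : ℝ) : ℂ) + l by push_cast; ring,
    show -(β : ℂ) + 1 = ((-β + 1 : ℝ) : ℂ) by push_cast; ring, e, ← e2]
  ring

theorem swap_left_ne (hβ : ∀ k : ℕ, β + k ≠ 0) (k : ℕ) : β - 1 + 1 + k ≠ 0 := by
  rw [sub_add_cancel]; exact hβ k

/-- The seed is P_l(z; α, β) itself, a solution with θ = l. -/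
theorem hasCirclePairing_one (l m n : ℕ) (h : -1 < α + β) (hα : ∀ k : ℕ, α + 1 + k ≠ 0)
    (hβ : ∀ k : ℕ, β + k ≠ 0) (hden : ∀ z : ℂ, ‖z‖ = 1 → xhrDenom .one l α β z ≠ 0) :
    HasCirclePairing (xhrWeight .one l α β) (xhrPoly .one l m α β) (xhrPartner .one l n α β)
      (if m = n then (xhrNorm .one l n α β : ℂ) else 0) := by
  have hD : ∀ z : ℂ, ‖z‖ = 1 → (hrPolynomial l α β).eval z ≠ 0 := fun z hz => by
    rw [← hrPoly_eq_eval fun k _ => hβ k]; exact hden z hz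
  refine hasCirclePairing_of_hasCircleMean ?_
  have key := hasCircleMean_seed (a := 0) (s := 0) (θ := l) h hα hβ (by simp)
    (hrPolynomial l α β) hD (fun z _ => by
      have := hrPolynomial_ode l α β z
      simp only [powLogDeriv, Complex.ofReal_zero, zero_div, neg_zero, add_zero, mul_zero]
      push_cast
      linear_combination this) m n
  refine key.congr fun z hz => ?_
  have h0 := ne_zero_of_mem_puncturedCircle hz
  have hD0 := hD z hz.1
  have hA : (((ascPochhammer ℝ l).eval (α + 1) : ℝ) : ℂ) ≠ 0 := by
    exact_mod_cast ascPochhammer_eval_ne_zero fun k _ => hα k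
  have hB : (((ascPochhammer ℝ l).eval β : ℝ) : ℂ) ≠ 0 := by
    exact_mod_cast ascPochhammer_eval_ne_zero fun k _ => hβ k
  have hB' : (((ascPochhammer ℝ n).eval β : ℝ) : ℂ) ≠ 0 := by
    exact_mod_cast ascPochhammer_eval_ne_zero fun k _ => hβ k
  have hl := pow_ne_zero l h0
  have hn := pow_ne_zero n h0
  rw [xhrPartner, xhrPoly_one_eq l m hα hβ, xhrPoly_one_eq l n (swap_left_ne hβ) hα,
    hrPolynomial_eval_inv' (α := α) (fun k _ => hα k) rfl rfl h0,
    hrPolynomial_eval_inv' (α := α) (fun k _ => hα k) rfl rfl h0,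
    derivative_hrPolynomial_eval_inv (α := α) (fun k _ => hα k) rfl rfl h0,
    derivative_hrPolynomial_eval_inv (α := α) (fun k _ => hα k) rfl rfl h0]
  simp only [xhrWeight, xhrDenom, powLogDeriv]
  rw [hrPoly_eq_eval fun k _ => hβ k, add_comm 1 α]
  push_cast
  simp only [zero_div, add_zero, zero_mul]
  field_simp
  ring

/-- The seed is (1-z)^(-(α+β)) P_l(z; -β, -α). Its logarithmic derivative has residue proportional
to α + β at 1, so the case α + β = 0 has no pole and needs no stronger bound. -/
theorem hasCirclePairing_two (m n : ℕ) (h : 0 ≤ α + β) (hα : ∀ k : ℕ, α + 1 + k ≠ 0)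
    (hβ : ∀ k : ℕ, β + k ≠ 0) (hα' : ∀ k < l, -α + k ≠ 0) (hβ' : ∀ k < l, -β + 1 + k ≠ 0)
    (hden : ∀ z : ℂ, ‖z‖ = 1 → xhrDenom .two l α β z ≠ 0) :
    HasCirclePairing (xhrWeight .two l α β) (xhrPoly .two l m α β) (xhrPartner .two l n α β)
      (if m = n then (xhrNorm .two l n α β : ℂ) else 0) := by
  have hD : ∀ z : ℂ, ‖z‖ = 1 → (hrPolynomial l (-β) (-α)).eval z ≠ 0 := fun z hz => by
    rw [← hrPoly_eq_eval hα']; exact hden z hz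
  refine hasCirclePairing_of_hasCircleMean ?_
  have key := hasCircleMean_seed (a := 0) (s := α + β) (θ := l - α - β) (by linarith) hα hβ
    (fun hne => lt_of_le_of_ne h hne.symm)
    (hrPolynomial l (-β) (-α)) hD (fun z hz => by
      have h1 := one_sub_ne_zero_of_mem_puncturedCircle hz
      have := hrPolynomial_ode l (-β) (-α) z
      simp only [powLogDeriv, Complex.ofReal_zero, zero_div, neg_zero, zero_add]
      push_cast at this ⊢
      field_simp
      linear_combination (1 - z) * this) m n
  refine key.congr fun z hz => ?_
  have h0 := ne_zero_of_mem_puncturedCircle hz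
  have h1 := one_sub_ne_zero_of_mem_puncturedCircle hz
  have hD0 := hD z hz.1
  have hA : (((ascPochhammer ℝ l).eval (-α) : ℝ) : ℂ) ≠ 0 := by
    exact_mod_cast ascPochhammer_eval_ne_zero hα'
  have hB : (((ascPochhammer ℝ l).eval (-β + 1) : ℝ) : ℂ) ≠ 0 := by
    exact_mod_cast ascPochhammer_eval_ne_zero hβ'
  have hB' : (((ascPochhammer ℝ n).eval β : ℝ) : ℂ) ≠ 0 := by
    exact_mod_cast ascPochhammer_eval_ne_zero fun k _ => hβ k
  have hl := pow_ne_zero l h0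
  have hn := pow_ne_zero n h0
  rw [xhrPartner, xhrPoly_two_eq m hα hβ hα' hβ',
    xhrPoly_two_eq n (swap_left_ne hβ) hα (fun k hk => by convert hβ' k hk using 1; ring)
      (fun k hk => by convert hα' k hk using 1; ring),
    hrPolynomial_eval_inv' (α := α) (fun k _ => hα k) rfl rfl h0,
    hrPolynomial_eval_inv' (α := -β) (β := -α) hβ' (by ring) (by ring) h0,
    derivative_hrPolynomial_eval_inv (α := α) (fun k _ => hα k) rfl rfl h0,
    derivative_hrPolynomial_eval_inv (α := -β) (β := -α) hβ' (by ring) (by ring) h0]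
  simp only [xhrWeight, xhrDenom, powLogDeriv]
  rw [hrPoly_eq_eval hα']
  push_cast
  simp only [zero_div, zero_add]
  rw [pow_add, pow_one]
  field_simp
  ring

/-- The seed is z^(-α-1-l) P_l(z; β-1, α+1), that is, z^(-α-1) P_l(1/z; α, β) up to a constant. -/
theorem hasCirclePairing_three (l m n : ℕ) (h : -1 < α + β) (hα : ∀ k : ℕ, α + 1 + k ≠ 0)
    (hβ : ∀ k : ℕ, β + k ≠ 0) (hden : ∀ z : ℂ, ‖z‖ = 1 → xhrDenom .three l α β z ≠ 0) :
    HasCirclePairing (xhrWeight .three l α β) (xhrPoly .three l m α β) (xhrPartner .three l n α β)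
      (if m = n then (xhrNorm .three l n α β : ℂ) else 0) := by
  have hD : ∀ z : ℂ, ‖z‖ = 1 → (hrPolynomial l (β - 1) (α + 1)).eval z ≠ 0 := fun z hz => by
    rw [← hrPoly_eq_eval fun k _ => hα k]; exact hden z hz
  refine hasCirclePairing_of_hasCircleMean ?_
  have key := hasCircleMean_seed (a := -(l + 1 + α)) (s := 0) (θ := -l - 1 - α - β) h hα hβ
    (by simp) (hrPolynomial l (β - 1) (α + 1)) hD (fun z hz => by
      have h0 := ne_zero_of_mem_puncturedCircle hz
      have := hrPolynomial_ode l (β - 1) (α + 1) z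
      simp only [powLogDeriv, Complex.ofReal_zero, zero_div, add_zero]
      push_cast at this ⊢
      field_simp
      linear_combination z * this) m n
  refine key.congr fun z hz => ?_
  have h0 := ne_zero_of_mem_puncturedCircle hz
  have hD0 := hD z hz.1
  have hA : (((ascPochhammer ℝ l).eval (α + 1) : ℝ) : ℂ) ≠ 0 := by
    exact_mod_cast ascPochhammer_eval_ne_zero fun k _ => hα k
  have hB : (((ascPochhammer ℝ l).eval β : ℝ) : ℂ) ≠ 0 := by
    exact_mod_cast ascPochhammer_eval_ne_zero fun k _ => hβ k
  have hB' : (((ascPochhammer ℝ n).eval β : ℝ) : ℂ) ≠ 0 := by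
    exact_mod_cast ascPochhammer_eval_ne_zero fun k _ => hβ k
  have hl := pow_ne_zero l h0
  have hn := pow_ne_zero n h0
  rw [xhrPartner, xhrPoly_three_eq l m hα hβ, xhrPoly_three_eq l n (swap_left_ne hβ) hα,
    hrPolynomial_eval_inv' (α := α) (fun k _ => hα k) rfl rfl h0,
    hrPolynomial_eval_inv' (α := β - 1) (β := α + 1) (fun k _ => swap_left_ne hβ k) rfl rfl h0,
    derivative_hrPolynomial_eval_inv (α := α) (fun k _ => hα k) rfl rfl h0,
    derivative_hrPolynomial_eval_inv (α := β - 1) (β := α + 1) (fun k _ => swap_left_ne hβ k)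
      rfl rfl h0, sub_add_cancel]
  simp only [xhrWeight, xhrDenom, powLogDeriv]
  rw [hrPoly_eq_eval fun k _ => hα k, add_comm 1 α]
  push_cast
  simp only [zero_div, add_zero]
  field_simp
  ring

theorem hrPolynomial_four_eval_inv (hα' : ∀ k < l, -α + k ≠ 0) {z : ℂ} (hz : z ≠ 0) :
    (hrPolynomial l (-(β - 1) - 1) (-(α + 1) + 1)).eval z⁻¹ =
      (((ascPochhammer ℝ l).eval (-α) / (ascPochhammer ℝ l).eval (-β + 1) : ℝ) : ℂ) *
        (z ^ l)⁻¹ * (hrPolynomial l (-α - 1) (-β + 1)).eval z := by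
  rw [hrPolynomial_eval_inv' (α := -α - 1) (β := -β + 1)
    (fun k hk => by rw [sub_add_cancel]; exact hα' k hk) (by ring) (by ring) hz, sub_add_cancel]

theorem derivative_hrPolynomial_four_eval_inv (hα' : ∀ k < l, -α + k ≠ 0) {z : ℂ} (hz : z ≠ 0) :
    (derivative (hrPolynomial l (-(β - 1) - 1) (-(α + 1) + 1))).eval z⁻¹ =
      (((ascPochhammer ℝ l).eval (-α) / (ascPochhammer ℝ l).eval (-β + 1) : ℝ) : ℂ) *
        (z ^ l)⁻¹ * (z * (l * (hrPolynomial l (-α - 1) (-β + 1)).eval z -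
          z * (derivative (hrPolynomial l (-α - 1) (-β + 1))).eval z)) := by
  rw [derivative_hrPolynomial_eval_inv (α := -α - 1) (β := -β + 1)
    (fun k hk => by rw [sub_add_cancel]; exact hα' k hk) (by ring) (by ring) hz, sub_add_cancel]

/-- The partner of the fourth type on the circle, in terms of the polynomials at `z`. -/
theorem xhrPartner_four_inv (n : ℕ) (hα : ∀ k : ℕ, α + 1 + k ≠ 0) (hβ : ∀ k : ℕ, β + k ≠ 0)
    (hα' : ∀ k < l, -α + k ≠ 0) (hβ' : ∀ k < l, -β + 1 + k ≠ 0) {z : ℂ} (h0 : z ≠ 0) :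
    xhrPartner .four l n α β z⁻¹ =
      (((ascPochhammer ℝ n).eval (α + 1) / (ascPochhammer ℝ n).eval β : ℝ) : ℂ) *
      ((z ^ l)⁻¹ * (z ^ n)⁻¹ * z⁻¹ * ((z - 1) *
        (z * ((hrPolynomial l (-α - 1) (-β + 1)).eval z *
            (derivative (hrPolynomial n α β)).eval z -
          (derivative (hrPolynomial l (-α - 1) (-β + 1))).eval z * (hrPolynomial n α β).eval z) -
        (n + β) * (hrPolynomial l (-α - 1) (-β + 1)).eval z * (hrPolynomial n α β).eval z) +
      (α + β) * z * (hrPolynomial l (-α - 1) (-β + 1)).eval z * (hrPolynomial n α β).eval z)) := by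
  have hA : (((ascPochhammer ℝ l).eval (-α) : ℝ) : ℂ) ≠ 0 := by
    exact_mod_cast ascPochhammer_eval_ne_zero hα'
  have hB : (((ascPochhammer ℝ l).eval (-β + 1) : ℝ) : ℂ) ≠ 0 := by
    exact_mod_cast ascPochhammer_eval_ne_zero hβ'
  have hB' : (((ascPochhammer ℝ n).eval β : ℝ) : ℂ) ≠ 0 := by
    exact_mod_cast ascPochhammer_eval_ne_zero fun k _ => hβ k
  have hl := pow_ne_zero l h0
  have hn := pow_ne_zero n h0
  rw [xhrPartner,
    xhrPoly_four_eq n (swap_left_ne hβ) hα (fun k hk => by convert hα' k hk using 1; ring),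
    hrPolynomial_eval_inv' (α := α) (fun k _ => hα k) rfl rfl h0, hrPolynomial_four_eval_inv hα' h0,
    derivative_hrPolynomial_eval_inv (α := α) (fun k _ => hα k) rfl rfl h0,
    derivative_hrPolynomial_four_eval_inv hα' h0,
    show -(β - 1) = -β + 1 by ring, show -(α + 1) + 1 = -α by ring]
  push_cast
  field_simp
  ring

/-- The seed combines the two previous modifications: z^(β-1-l) (1-z)^(-(α+β)) P_l(z; -α-1, 1-β). -/
theorem hasCirclePairing_four (m n : ℕ) (h : 0 ≤ α + β) (hα : ∀ k : ℕ, α + 1 + k ≠ 0)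
    (hβ : ∀ k : ℕ, β + k ≠ 0) (hα' : ∀ k < l, -α + k ≠ 0) (hβ' : ∀ k < l, -β + 1 + k ≠ 0)
    (hden : ∀ z : ℂ, ‖z‖ = 1 → xhrDenom .four l α β z ≠ 0) :
    HasCirclePairing (xhrWeight .four l α β) (xhrPoly .four l m α β) (xhrPartner .four l n α β)
      (if m = n then (xhrNorm .four l n α β : ℂ) else 0) := by
  have hD : ∀ z : ℂ, ‖z‖ = 1 → (hrPolynomial l (-α - 1) (-β + 1)).eval z ≠ 0 := fun z hz => by
    rw [← hrPoly_eq_eval hβ']; exact hden z hz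
  refine hasCirclePairing_of_hasCircleMean ?_
  have key := hasCircleMean_seed (a := β - l - 1) (s := α + β) (θ := -l - 1) (by linarith) hα hβ
    (fun hne => lt_of_le_of_ne h hne.symm)
    (hrPolynomial l (-α - 1) (-β + 1)) hD (fun z hz => by
      have h0 := ne_zero_of_mem_puncturedCircle hz
      have h1 := one_sub_ne_zero_of_mem_puncturedCircle hz
      have := hrPolynomial_ode l (-α - 1) (-β + 1) z
      simp only [powLogDeriv]
      push_cast at this ⊢
      field_simp
      linear_combination z * (1 - z) * this) m n
  refine key.congr fun z hz => ?_
  have h0 := ne_zero_of_mem_puncturedCircle hz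
  have h1 := one_sub_ne_zero_of_mem_puncturedCircle hz
  have hD0 := hD z hz.1
  have hA : (((ascPochhammer ℝ l).eval (-α) : ℝ) : ℂ) ≠ 0 := by
    exact_mod_cast ascPochhammer_eval_ne_zero hα'
  have hB : (((ascPochhammer ℝ l).eval (-β + 1) : ℝ) : ℂ) ≠ 0 := by
    exact_mod_cast ascPochhammer_eval_ne_zero hβ'
  have hB' : (((ascPochhammer ℝ n).eval β : ℝ) : ℂ) ≠ 0 := by
    exact_mod_cast ascPochhammer_eval_ne_zero fun k _ => hβ k
  have hl := pow_ne_zero l h0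
  have hn := pow_ne_zero n h0
  rw [xhrPartner_four_inv n hα hβ hα' hβ' h0, xhrPoly_four_eq m hα hβ hβ']
  simp only [xhrWeight, xhrDenom, powLogDeriv]
  rw [hrPoly_eq_eval hβ', pow_add, pow_one]
  push_cast
  field_simp
  ring

/-! ### The additional state of type four. -/

/-- The derivative along the circle of `w * g` has mean value zero. -/
theorem hasCircleMean_hrWeight_mul_deriv (h : 0 < α + β) {g g' : ℂ → ℂ}
    (hg : ∀ z, ‖z‖ = 1 → HasDerivAt g (g' z) z) (hg' : ContinuousOn g' {z | ‖z‖ = 1}) :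
    HasCircleMean (fun z => hrWeight α β z *
      (z * g' z - β * g z - (α + β) * z / (1 - z) * g z)) 0 := by
  have hgc : ContinuousOn g {z | ‖z‖ = 1} := fun z hz => (hg z hz).continuousAt.continuousWithinAt
  have hint := (circleIntegrable_hrWeight_mul (α := α - 1) (β := β) (by linarith)
    (g := fun z => (1 - z) * (z * g' z - β * g z) - (α + β) * z * g z)
    (by fun_prop)).hasCircleMean.congr (g := fun z => hrWeight α β z *
      (z * g' z - β * g z - (α + β) * z / (1 - z) * g z)) fun z hz => by
    have h1 := one_sub_ne_zero_of_mem_puncturedCircle hz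
    have hw := one_sub_mul_hrWeight (α - 1) β hz
    rw [sub_add_cancel] at hw
    rw [← hw]
    field_simp
  refine hasCircleMean_zero_of_hasDerivAt hint.1 (fun z hz => ?_) (tendsto_hrWeight_mul h hgc)
  have h0 := ne_zero_of_mem_puncturedCircle hz
  have h1 := one_sub_ne_zero_of_mem_puncturedCircle hz
  refine HasDerivAt.congr_deriv (f := fun z => hrWeight α β z * g z)
    ((hasDerivAt_hrWeight α β hz).mul (hg z hz.1)) ?_
  field_simp
  ring

theorem hasDerivAt_mul_div_eval {D p : ℂ[X]} {v v' : ℂ → ℂ} {z : ℂ} (hD : D.eval z ≠ 0)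
    (hv : HasDerivAt v (v' z) z) :
    HasDerivAt (fun z => v z * p.eval z / D.eval z)
      ((v' z * p.eval z + v z * (derivative p).eval z -
        v z * p.eval z * (derivative D).eval z / D.eval z) / D.eval z) z := by
  refine ((hv.mul (p.hasDerivAt z)).div (D.hasDerivAt z) hD).congr_deriv ?_
  simp only [Pi.mul_apply]
  field_simp

theorem continuousOn_mul_div_eval_deriv {D p : ℂ[X]} {v v' : ℂ → ℂ} {S : Set ℂ}
    (hD : ∀ z ∈ S, D.eval z ≠ 0) (hv : ContinuousOn v S) (hv' : ContinuousOn v' S) :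
    ContinuousOn (fun z => (v' z * p.eval z + v z * (derivative p).eval z -
        v z * p.eval z * (derivative D).eval z / D.eval z) / D.eval z) S := by
  have hp := p.continuous.continuousOn (s := S)
  have hp' := (derivative p).continuous.continuousOn (s := S)
  have hDc := D.continuous.continuousOn (s := S)
  have hDc' := (derivative D).continuous.continuousOn (s := S)
  exact (((hv'.mul hp).add (hv.mul hp')).sub (((hv.mul hp).mul hDc').div hDc hD)).div hDc hD

/-- Besides continuous factors the weight is w / (1-z), which is w with α - 1 in place of α; it is
integrable because α + β > 0. -/
theorem hasCirclePairing_four_one_one (h : 0 < α + β) (hβ' : ∀ k < l, -β + 1 + k ≠ 0)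
    (hden : ∀ z : ℂ, ‖z‖ = 1 → xhrDenom .four l α β z ≠ 0) :
    ∃ c : ℂ, HasCirclePairing (xhrWeight .four l α β) (fun _ => 1) (fun _ => 1) c := by
  have hD : ∀ z : ℂ, ‖z‖ = 1 → (hrPolynomial l (-α - 1) (-β + 1)).eval z ≠ 0 := fun z hz => by
    rw [← hrPoly_eq_eval hβ']; exact hden z hz
  refine ⟨_, hasCirclePairing_of_hasCircleMean ((circleIntegrable_hrWeight_mul
    (α := α - 1) (β := β) (by linarith) (g := fun z =>
    (((ascPochhammer ℝ l).eval (-β + 1) / (ascPochhammer ℝ l).eval (-α) : ℝ) : ℂ) *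
      (z ^ (1 + l) / (hrPolynomial l (-α - 1) (-β + 1)).eval z ^ 2))
    ?_).hasCircleMean.congr fun z hz => ?_)⟩
  · exact continuousOn_const.mul ((continuous_pow _).continuousOn.div
      ((Polynomial.continuous _).pow 2).continuousOn fun z hz => pow_ne_zero 2 (hD z hz))
  · have h1 := one_sub_ne_zero_of_mem_puncturedCircle hz
    have hD0 := hD z hz.1
    have hw := one_sub_mul_hrWeight (α - 1) β hz
    rw [sub_add_cancel] at hw
    simp only [xhrWeight, xhrDenom]
    rw [hrPoly_eq_eval hβ', ← hw]
    field_simp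

/-- For this seed 1/φ is a constant times z^(l+1) w / D. As (P_n/φ)' = (P_n' - r P_n)/φ, the
integrand is, up to sign, the derivative of w · z^(l+1) P_n / D. -/
theorem hasCirclePairing_four_left (n : ℕ) (h : 0 < α + β) (hα : ∀ k : ℕ, α + 1 + k ≠ 0)
    (hβ : ∀ k : ℕ, β + k ≠ 0) (hα' : ∀ k < l, -α + k ≠ 0) (hβ' : ∀ k < l, -β + 1 + k ≠ 0)
    (hden : ∀ z : ℂ, ‖z‖ = 1 → xhrDenom .four l α β z ≠ 0) :
    HasCirclePairing (xhrWeight .four l α β) (xhrPoly .four l n α β) (fun _ => 1) 0 := by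
  have hD : ∀ z : ℂ, ‖z‖ = 1 → (hrPolynomial l (-α - 1) (-β + 1)).eval z ≠ 0 := fun z hz => by
    rw [← hrPoly_eq_eval hβ']; exact hden z hz
  refine hasCirclePairing_of_hasCircleMean ?_
  have key := (hasCircleMean_hrWeight_mul_deriv h
    (fun z hz => hasDerivAt_mul_div_eval (p := hrPolynomial n α β) (v := fun z => z ^ (l + 1))
      (v' := fun z => ((l + 1 : ℕ) : ℂ) * z ^ l) (hD z hz) (hasDerivAt_pow (l + 1) z))
    (continuousOn_mul_div_eval_deriv hD (by fun_prop) (by fun_prop))).const_mul (-1)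
  rw [mul_zero] at key
  refine key.congr fun z hz => ?_
  have h0 := ne_zero_of_mem_puncturedCircle hz
  have h1 := one_sub_ne_zero_of_mem_puncturedCircle hz
  have hD0 := hD z hz.1
  have hA : (((ascPochhammer ℝ l).eval (-α) : ℝ) : ℂ) ≠ 0 := by
    exact_mod_cast ascPochhammer_eval_ne_zero hα'
  have hB : (((ascPochhammer ℝ l).eval (-β + 1) : ℝ) : ℂ) ≠ 0 := by
    exact_mod_cast ascPochhammer_eval_ne_zero hβ'
  rw [xhrPoly_four_eq n hα hβ hβ']
  simp only [xhrWeight, xhrDenom]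
  rw [hrPoly_eq_eval hβ', add_comm 1 l, pow_succ]
  push_cast
  field_simp
  ring

/-- Here θ = -l-1, so n - θ = n + l + 1 and B/φ is z^(n+l+1) times z d/dz of z^(-n-l-1) P_n/φ. Up to
constants the integrand is thus the derivative of w · z^(-n) P_n / D. -/
theorem hasCirclePairing_four_right (n : ℕ) (h : 0 < α + β) (hα : ∀ k : ℕ, α + 1 + k ≠ 0)
    (hβ : ∀ k : ℕ, β + k ≠ 0) (hα' : ∀ k < l, -α + k ≠ 0) (hβ' : ∀ k < l, -β + 1 + k ≠ 0)
    (hden : ∀ z : ℂ, ‖z‖ = 1 → xhrDenom .four l α β z ≠ 0) :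
    HasCirclePairing (xhrWeight .four l α β) (fun _ => 1) (xhrPartner .four l n α β) 0 := by
  have hD : ∀ z : ℂ, ‖z‖ = 1 → (hrPolynomial l (-α - 1) (-β + 1)).eval z ≠ 0 := fun z hz => by
    rw [← hrPoly_eq_eval hβ']; exact hden z hz
  have hne : ∀ z : ℂ, ‖z‖ = 1 → z ≠ 0 := fun z hz =>
    norm_ne_zero_iff.mp (by rw [hz]; exact one_ne_zero)
  refine hasCirclePairing_of_hasCircleMean ?_
  have key := (hasCircleMean_hrWeight_mul_deriv h
    (fun z hz => hasDerivAt_mul_div_eval (p := hrPolynomial n α β) (v := fun z => (z ^ n)⁻¹)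
      (v' := fun z => -(n : ℂ) * ((z ^ n)⁻¹ * z⁻¹)) (hD z hz) ?_)
    (continuousOn_mul_div_eval_deriv hD (continuousOn_inv_pow_circle n)
      (continuousOn_const.mul ((continuousOn_inv_pow_circle n).mul
        (continuousOn_id.inv₀ hne))))).const_mul
      (-((((ascPochhammer ℝ l).eval (-β + 1) / (ascPochhammer ℝ l).eval (-α) : ℝ) : ℂ) *
      (((ascPochhammer ℝ n).eval (α + 1) / (ascPochhammer ℝ n).eval β : ℝ) : ℂ)))
  · rw [mul_zero] at key
    refine key.congr fun z hz => ?_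
    have h0 := ne_zero_of_mem_puncturedCircle hz
    have h1 := one_sub_ne_zero_of_mem_puncturedCircle hz
    have hD0 := hD z hz.1
    have hA : (((ascPochhammer ℝ l).eval (-α) : ℝ) : ℂ) ≠ 0 := by
      exact_mod_cast ascPochhammer_eval_ne_zero hα'
    have hB' : (((ascPochhammer ℝ n).eval β : ℝ) : ℂ) ≠ 0 := by
      exact_mod_cast ascPochhammer_eval_ne_zero fun k _ => hβ k
    have hl := pow_ne_zero l h0
    have hn := pow_ne_zero n h0
    rw [xhrPartner_four_inv n hα hβ hα' hβ' h0]
    simp only [xhrWeight, xhrDenom]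
    rw [hrPoly_eq_eval hβ', pow_add, pow_one]
    push_cast
    field_simp
    ring
  · refine ((hasDerivAt_pow n z).inv (pow_ne_zero n (hne z hz))).congr_deriv ?_
    have h0 := hne z hz
    rcases n with _ | n
    · simp
    · rw [Nat.add_sub_cancel, pow_succ]
      field_simp
      ring

end Seeds

end Exceptional

end

/-- Biorthogonality of the four types of exceptional Hendriksen--van Rossum polynomials. The last
clause concerns the state that is added for the fourth type, whose polynomial and partner are the
constant `1`. -/
theorem mainTheorem1 (j : SeedType) (l : ℕ) (hl : 1 ≤ l) (α β : ℝ)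
    (hαβ : -1 < α + β)
    (hα : ∀ k : ℕ, α + 1 + k ≠ 0)
    (hβ : ∀ k : ℕ, β + k ≠ 0)
    (hreg : j = SeedType.two ∨ j = SeedType.four →
      (∀ k : ℕ, k < l → -α + k ≠ 0) ∧ (∀ k : ℕ, k < l → -β + 1 + k ≠ 0))
    (hconv : j = SeedType.two ∨ j = SeedType.four → 0 ≤ α + β)
    (hden : ∀ z : ℂ, ‖z‖ = 1 → xhrDenom j l α β z ≠ 0) :
    (∀ m n : ℕ, (j = SeedType.one → m ≠ l ∧ n ≠ l) →
      HasCirclePairing (xhrWeight j l α β) (xhrPoly j l m α β) (xhrPartner j l n α β)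
        (if m = n then (xhrNorm j l n α β : ℂ) else 0)) ∧
    (j = SeedType.four → 0 < α + β →
      (∃ c : ℂ, HasCirclePairing (xhrWeight j l α β) (fun _ => 1) (fun _ => 1) c) ∧
      ∀ n : ℕ,
        HasCirclePairing (xhrWeight j l α β) (xhrPoly j l n α β) (fun _ => 1) 0 ∧
        HasCirclePairing (xhrWeight j l α β) (fun _ => 1) (xhrPartner j l n α β) 0) := by
  refine ⟨fun m n _ => ?_, ?_⟩
  · cases j with
    | one => exact hasCirclePairing_one l m n hαβ hα hβ hden
    | two =>
      obtain ⟨hα', hβ'⟩ := hreg (Or.inl rfl)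
      exact hasCirclePairing_two m n (hconv (Or.inl rfl)) hα hβ hα' hβ' hden
    | three => exact hasCirclePairing_three l m n hαβ hα hβ hden
    | four =>
      obtain ⟨hα', hβ'⟩ := hreg (Or.inr rfl)
      exact hasCirclePairing_four m n (hconv (Or.inr rfl)) hα hβ hα' hβ' hden
  · rintro rfl h
    obtain ⟨hα', hβ'⟩ := hreg (Or.inr rfl)
    exact ⟨hasCirclePairing_four_one_one h hβ' hden, fun n =>
      ⟨hasCirclePairing_four_left n h hα hβ hα' hβ' hden,
        hasCirclePairing_four_right n h hα hβ hα' hβ' hden⟩⟩
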